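/- Let $\beta>0$, $\kappa\in(0,\infty)$, and let $\gamma\ge 1$ be an integer. Let $\Sigma$ be a closed subinterval of $\mathbb R$, with $\Sigma\subseteq[0,\infty)$ if $\gamma$ is even. Let $(p(n))_{n\ge1}$ be nonnegative integers with $p(n)/n\to\kappa$ (so $p(n)\to\infty$), and let $w_n:\Sigma\to[0,\infty)$ be continuous. For a function $f$ write $\mathcal N(f)$ for its set of zeros. Assume: (a1) There is a continuous function $w:\Sigma\to[0,\infty)$ such that $\mathcal N(w)$ is finite, $\mathcal N(w_n)\subseteq\mathcal N(w)$ for all large $n$, $w_n\to w$ uniformly on compact subsets of $\Sigma$, $\log w_n\to\log w$ uniformly on compact subsets of $\Sigma\setminus\mathcal N(w)$, and $\log w$ is Lipschitz on each compact subset of $\Sigma\setminus\mathcal N(w)$. (a2) If $\Sigma$ is unbounded, then there are $n_0\in\mathbb N$ and $\epsilon>0$ with $$\lim_{|x|\to\infty,\ x\in\Sigma}|x|^{\gamma\kappa\max(\beta,1)+\epsilon}\,\sup_{n\ge n_0}w_n(x)=0 .$$ On a probability space $(\Omega,\mathcal F,\mathbb P)$, for each $n\ge1$ let $\Lambda_n=(\lambda_1,\dots,\lambda_{p(n)})$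 be a random vector in $\Sigma^{p(n)}$ whose law has density $$q_n(x)=\frac1{Z_n}\prod_{1\le i<j\le p(n)}|x_i^\gamma-x_j^\gamma|^\beta\prod_{j=1}^{p(n)}w_n(x_j)^n$$ with respect to Lebesgue measure on $\Sigma^{p(n)}$, where $Z_n\in(0,\infty)$ is the normalizing constant; no assumption is made on the joint law of $(\Lambda_n)_{n\ge1}$. For $x\in\Sigma^{p(n)}$ let $L_n(x)=\frac1{p(n)}\sum_{j=1}^{p(n)}\delta_{x_j}$. For a Borel probability measure $\mu$ on $\Sigma$ put $$I(\mu)=\frac\beta2\kappa^2\iint\log|x^\gamma-y^\gamma|^{-1}\,\mu(dx)\,\mu(dy)-\kappa\int\log w\,d\mu+c\ ,\qquad c=\lim_{n\to\infty}\frac1{n^2}\log Z_n ,$$ where $c$ is taken in $[-\infty,\infty]$ as a $\limsup$, and where the first two terms together mean $\iint F\,d\mu\,d\mu\in(-\infty,\infty]$ for the kernel $$F(x,y)=\frac\beta2\kappa^2\log|x^\gamma-y^\gamma|^{-1}-\frac\kappa2\bigl(\log w(x)+\log w(y)\bigr),$$ which is bounded from below and has the value $+\infty$ if $x^\gamma=y^\gamma$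 or $w(x)=0$ or $w(y)=0$. If $I$ has a unique minimizer $\mu^*$ among the Borel probability measures on $\Sigma$, then $$\mathbb P\bigl(L_n\circ\Lambda_n\to\mu^*\text{ weakly as }n\to\infty\bigr)=1 .$$ -/

import Mathlib

open MeasureTheory Filter Topology ProbabilityTheory
open scoped ENNReal NNReal

noncomputable section

namespace LogGas

/-- The unnormalized density
`∏_{i<j} |x_i ^ γ - x_j ^ γ| ^ β * ∏_j v(x_j) ^ n` on `S ^ m`. -/
def weight {S : Set ℝ} (β : ℝ) (γ n : ℕ) (v : S → ℝ) {m : ℕ} (x : Fin m → S) : ℝ :=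
  (∏ i : Fin m, ∏ j ∈ Finset.Ioi i, |(x i : ℝ) ^ γ - (x j : ℝ) ^ γ| ^ β) * ∏ j : Fin m, v (x j) ^ n

/-- The restriction to `S ^ m` of Lebesgue measure on `ℝ ^ m`, that is, the `m`-fold product
of Lebesgue measure on the closed set `S`. -/
def lebesgue (S : Set ℝ) (m : ℕ) : Measure (Fin m → S) :=
  Measure.pi fun _ => Measure.comap ((↑) : S → ℝ) volume

/-- The normalizing constant `Z`, an integral with values in `[0, ∞]`. -/
def partitionFunction {S : Set ℝ} (β : ℝ) (γ n : ℕ) (v : S → ℝ) (m : ℕ) : ℝ≥0∞ :=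
  ∫⁻ x, ENNReal.ofReal (weight β γ n v x) ∂(lebesgue S m)

/-- The law on `S ^ m` with Lebesgue density `Z⁻¹ * weight`. It is a probability measure exactly
when `0 < Z < ∞` (for `Z = 0` and for `Z = ∞` it is the zero measure). -/
def ensembleLaw {S : Set ℝ} (β : ℝ) (γ n : ℕ) (v : S → ℝ) (m : ℕ) : Measure (Fin m → S) :=
  (lebesgue S m).withDensity fun x =>
    (partitionFunction β γ n v m)⁻¹ * ENNReal.ofReal (weight β γ n v x)

/-- The empirical measure `m⁻¹ * ∑_j δ_{x_j}`. It is a probability measure for `m ≥ 1`,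
and the zero measure for `m = 0`. -/
def empiricalMeasure {S : Set ℝ} {m : ℕ} (x : Fin m → S) : FiniteMeasure S :=
  (m : ℝ≥0)⁻¹ • ∑ j : Fin m, (diracProba (x j)).toFiniteMeasure

/-- The assumptions on the limit `w` of the weights `w_n`. -/
structure WeightLimit {S : Set ℝ} (wn : ℕ → S → ℝ) (w : S → ℝ) : Prop where
  continuous : Continuous w
  nonneg : ∀ x, 0 ≤ w x
  finite_zeros : {x | w x = 0}.Finite
  zeros_subset : ∀ᶠ n in atTop, {x | wn n x = 0} ⊆ {x | w x = 0}
  tendsto : ∀ K : Set S, IsCompact K → TendstoUniformlyOn wn w atTop K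
  tendsto_log : ∀ K : Set S, IsCompact K → Disjoint K {x | w x = 0} →
    TendstoUniformlyOn (fun n x => Real.log (wn n x)) (fun x => Real.log (w x)) atTop K
  lipschitz_log : ∀ K : Set S, IsCompact K → Disjoint K {x | w x = 0} →
    ∃ C : ℝ≥0, LipschitzOnWith C (fun x => Real.log (w x)) K

/-- If `S` is unbounded, then for some `n₀` and `ε > 0`,
`|x| ^ (γ κ (β ∨ 1) + ε) * sup_{n ≥ n₀} w_n(x) → 0` as `|x| → ∞` in `S`.
The supremum is taken in `[0, ∞]`. -/
def WeightDecay {S : Set ℝ} (β κ : ℝ) (γ : ℕ) (wn : ℕ → S → ℝ) : Prop :=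
  ¬ Bornology.IsBounded S → ∃ n₀ : ℕ, ∃ ε : ℝ, 0 < ε ∧
    Tendsto (fun x : S => ENNReal.ofReal (|(x : ℝ)| ^ (γ * κ * max β 1 + ε)) *
        ⨆ n ≥ n₀, ENNReal.ofReal (wn n x))
      (comap (fun x : S => |(x : ℝ)|) atTop) (𝓝 0)

/-- The integral, in `[-∞, ∞]`, of an extended real function whose negative part
has a finite integral. -/
def erealIntegral {X : Type*} [MeasurableSpace X] (μ : Measure X) (f : X → EReal) : EReal :=
  ((∫⁻ x, (f x).toENNReal ∂μ : ℝ≥0∞) : EReal) - ((∫⁻ x, (-f x).toENNReal ∂μ : ℝ≥0∞) : EReal)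

open Classical in
/-- The kernel `F(x, y) = (β/2) κ² log |x^γ - y^γ|⁻¹ - (κ/2) (log w(x) + log w(y))`,
with the value `+∞` where `x^γ = y^γ` or `w(x) = 0` or `w(y) = 0`. -/
def kernel {S : Set ℝ} (β κ : ℝ) (γ : ℕ) (w : S → ℝ) (z : S × S) : EReal :=
  if (z.1 : ℝ) ^ γ = (z.2 : ℝ) ^ γ ∨ w z.1 = 0 ∨ w z.2 = 0 then ⊤
  else ((β / 2 * κ ^ 2 * Real.log (|(z.1 : ℝ) ^ γ - (z.2 : ℝ) ^ γ|⁻¹)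
    - κ / 2 * (Real.log (w z.1) + Real.log (w z.2)) : ℝ) : EReal)

/-- The weighted logarithmic energy
`(β/2) κ² ∬ log |x^γ - y^γ|⁻¹ μ(dx) μ(dy) - κ ∫ log w dμ`, as the single integral
`∬ F dμ dμ` of a kernel that is bounded from below. -/
def energy {S : Set ℝ} (β κ : ℝ) (γ : ℕ) (w : S → ℝ) (μ : ProbabilityMeasure S) : EReal :=
  erealIntegral ((μ : Measure S).prod (μ : Measure S)) (kernel β κ γ w)

/-- `c = lim n⁻² log Z_n` in `[-∞, ∞]`, written as a `limsup`. -/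
def freeEnergy {S : Set ℝ} (β : ℝ) (γ : ℕ) (p : ℕ → ℕ) (wn : ℕ → S → ℝ) : EReal :=
  limsup (fun n : ℕ =>
    ENNReal.log (partitionFunction β γ n (wn n) (p n)) / (((n : ℝ) ^ 2 : ℝ) : EReal)) atTop

/-- The rate function, the energy plus the constant `c`. -/
def rateFunction {S : Set ℝ} (β κ : ℝ) (γ : ℕ) (p : ℕ → ℕ) (wn : ℕ → S → ℝ) (w : S → ℝ)
    (μ : ProbabilityMeasure S) : EReal :=
  energy β κ γ w μ + freeEnergy β γ p wn

/-- `a` is a minimizer of `f`, and the only one. -/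
def IsUniqueMinimizer {X : Type*} (f : X → EReal) (a : X) : Prop :=
  (∀ b, f a ≤ f b) ∧ ∀ a', (∀ b, f a' ≤ f b) → a' = a

end LogGas

end

/-! No large deviation principle is needed: a lower bound on `Z_n` and a crude upper bound on the
mass of configurations of small weight suffice. Let `E` be the energy of the minimizer. The constant
`c` plays no role beyond being finite: otherwise the rate function would be constant and all Dirac
masses would be minimizers. Uniqueness for the rate function thus becomes uniqueness for the energy
(`exists_energy_eq_coe`).

Everything is written in nonnegative quantities. Dividing `|x^γ - y^γ|` by `((1+|x|)(1+|y|))^γ` and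
multiplying the weight by `(1+|x|)^a / C`, with `a = γκβ + ε`, gives factors in `[0,1]`, while the
surplus `ε` in the decay leaves a positive multiple of `log (1+|x|)`. So `-log weight` is, up to a
constant, a sum of nonnegative terms (`neg_log_weight_eq`), and the kernel is `excess - κ log C`
(`kernel_eq`).

Lower bound: for `e > E`, eventually `Z_n ≥ exp(-n² e)` (`eventually_exp_le_partitionFunction`). The
minimizer is replaced, at small cost of energy, by a measure `ν` with compact support away from the
zeros of `w` (`exists_compact_support`) and then with density at most `M`
(`exists_bounded_density`). Jensen's inequality for the product measure, which is at most `M^p(n)`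
times Lebesgue measure, bounds `Z_n` from below (`exp_le_partitionFunction`); `M` costs only `O(n)`
in the exponent.

Upper bound: on the event `weight < exp(-n²(E+δ))`, all but a power of order `1/n` of the weight is
bounded by the threshold, and the remaining power is integrable. Hence the event has probability at
most `exp(-n)` for large `n` (`eventually_ensembleLaw_le`). Borel–Cantelli, which sees only the
individual laws, gives `weight ≥ exp(-n²(E+δ))` eventually, almost surely, for every `δ > 0`.

The rest is deterministic (`tendsto_empiricalMeasure`). Such configurations have a bounded mean of
`log (1+|x|)`, so their empirical measures are relatively compact. Truncated logarithms are bounded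
and continuous, so they pass to the limit, and Fatou's lemma removes the truncation: every cluster
point has energy at most `E`, hence is the minimizer. -/

namespace LogGas

/-! ### Pair sums, product measures and Jensen's inequality -/

/-- A sum over all pairs of indices, for a symmetric summand, in terms of the diagonal and the
pairs `i < j`. -/
lemma sum_sum_eq_diag_add_two_mul {m : ℕ} (f : Fin m → Fin m → ℝ) (hf : ∀ i j, f i j = f j i) :
    ∑ i, ∑ j, f i j = ∑ i, f i i + 2 * ∑ i, ∑ j ∈ Finset.Ioi i, f i j := by
  have h1 : ∀ i : Fin m, ∑ j, f i j
      = f i i + ∑ j ∈ Finset.Ioi i, f i j + ∑ j ∈ Finset.Iio i, f i j := by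
    intro i
    have : (Finset.univ : Finset (Fin m)) = insert i (Finset.Ioi i ∪ Finset.Iio i) := by
      ext j
      simp only [Finset.mem_univ, Finset.mem_insert, Finset.mem_union, Finset.mem_Ioi,
        Finset.mem_Iio, true_iff]
      rcases lt_trichotomy i j with h | h | h <;> simp [h]
    rw [this, Finset.sum_insert (by simp), Finset.sum_union, add_assoc]
    rw [Finset.disjoint_left]
    intro j hj hj'
    simp only [Finset.mem_Ioi, Finset.mem_Iio] at hj hj'
    exact lt_asymm hj hj'
  have h2 : ∑ i : Fin m, ∑ j ∈ Finset.Iio i, f i j = ∑ i, ∑ j ∈ Finset.Ioi i, f i j := by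
    rw [Finset.sum_comm' (t' := Finset.univ) (s' := fun j => Finset.Ioi j) (by simp)]
    exact Finset.sum_congr rfl fun i _ => Finset.sum_congr rfl fun j _ => hf _ _
  simp_rw [h1, Finset.sum_add_distrib]
  rw [h2]
  ring

lemma pi_le_smul_pi {X : Type*} [MeasurableSpace X] {μ ν : Measure X} [SigmaFinite μ]
    [SigmaFinite ν] {M : ℝ≥0} (h : μ ≤ M • ν) (m : ℕ) :
    Measure.pi (fun _ : Fin m => μ) ≤ (M ^ m) • Measure.pi (fun _ : Fin m => ν) := by
  induction m with
  | zero =>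
    rw [pow_zero, one_smul, Measure.pi_of_empty (fun _ : Fin 0 => μ),
      Measure.pi_of_empty (fun _ : Fin 0 => ν)]
  | succ m ih =>
    have e : ∀ ρ : Measure X, ∀ [SigmaFinite ρ], Measure.pi (fun _ : Fin (m + 1) => ρ)
        = (ρ.prod (Measure.pi fun _ : Fin m => ρ)).map
          (MeasurableEquiv.piFinSuccAbove (fun _ => X) 0).symm := fun ρ _ =>
      ((measurePreserving_piFinSuccAbove (fun _ : Fin (m + 1) => ρ) 0).symm _).map_eq.symm
    rw [e μ, e ν]
    have : (M ^ (m + 1)) • (ν.prod (Measure.pi fun _ : Fin m => ν))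
        = (M • ν).prod ((M ^ m) • Measure.pi fun _ : Fin m => ν) := by
      have e1 : (M ^ m) • (Measure.pi fun _ : Fin m => ν)
        = ((M ^ m : ℝ≥0) : ℝ≥0∞) • (Measure.pi fun _ : Fin m => ν) := rfl
      have e2 : M • ν = ((M : ℝ≥0) : ℝ≥0∞) • ν := rfl
      rw [e1, e2, Measure.prod_smul_left, Measure.prod_smul_right, smul_smul, pow_succ',
        ← ENNReal.coe_mul]
      rfl
    rw [← Measure.map_smul, this]
    exact Measure.map_mono (Measure.prod_mono h ih) (MeasurableEquiv.measurable _)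

lemma map_eval_pair_pi {X : Type*} [MeasurableSpace X] (μ : Measure X) [IsProbabilityMeasure μ]
    {m : ℕ} {i j : Fin m} (hij : i ≠ j) :
    (Measure.pi fun _ : Fin m => μ).map (fun x => (x i, x j)) = μ.prod μ := by
  have h := iIndepFun_pi (μ := fun _ : Fin m => μ) (X := fun _ x => x)
    (fun _ => measurable_id.aemeasurable)
  have h2 := (indepFun_iff_map_prod_eq_prod_map_map (measurable_pi_apply i).aemeasurable
    (measurable_pi_apply j).aemeasurable).1 (h.indepFun hij)
  rw [h2, (measurePreserving_eval (fun _ : Fin m => μ) i).map_eq,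
    (measurePreserving_eval (fun _ : Fin m => μ) j).map_eq]

lemma measure_prod_diag {X : Type*} [MeasurableSpace X] [MeasurableEq X]
    (μ : Measure X) [SFinite μ] [NullSingletonClass μ] : (μ.prod μ) {z | z.1 = z.2} = 0 := by
  have hd : MeasurableSet {z : X × X | z.1 = z.2} :=
    measurableSet_eq_fun measurable_fst measurable_snd
  rw [Measure.measure_prod_null hd]
  refine Eventually.of_forall fun x => ?_
  have : Prod.mk x ⁻¹' {z : X × X | z.1 = z.2} = {x} := by
    ext y; simp [eq_comm]
  simp [this]

lemma nullSingletonClass_of_prod_diag {X : Type*} [MeasurableSpace X]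
    (μ : Measure X) [SFinite μ] (h : (μ.prod μ) {z | z.1 = z.2} = 0) : NullSingletonClass μ := by
  refine ⟨fun x => ?_⟩
  have h1 : (μ.prod μ) ({x} ×ˢ {x}) = 0 := by
    refine measure_mono_null ?_ h
    rintro ⟨a, b⟩ ⟨ha, hb⟩
    simp only [Set.mem_singleton_iff] at ha hb
    simp [ha, hb]
  rw [Measure.prod_prod] at h1
  exact mul_self_eq_zero.1 h1

lemma ofReal_integral_le_lintegral_ofReal {X : Type*} [MeasurableSpace X] {μ : Measure X}
    {f : X → ℝ} (hf : Integrable f μ) :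
    ENNReal.ofReal (∫ x, f x ∂μ) ≤ ∫⁻ x, ENNReal.ofReal (f x) ∂μ := by
  rw [integral_eq_lintegral_pos_part_sub_lintegral_neg_part hf]
  refine (ENNReal.ofReal_le_ofReal (sub_le_self _ ENNReal.toReal_nonneg)).trans ?_
  exact ENNReal.ofReal_toReal_le

/-- Jensen's inequality from the tangent line of `exp` at the mean `c`: `exp t ≥ exp c * (1 + (t -
c))`. With a lower integral on the right, `exp ∘ f` need not be integrable. -/
lemma ofReal_exp_integral_le_lintegral {X : Type*} [MeasurableSpace X] {μ : Measure X}
    [IsProbabilityMeasure μ] {f : X → ℝ} (hf : Integrable f μ) :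
    ENNReal.ofReal (Real.exp (∫ x, f x ∂μ)) ≤ ∫⁻ x, ENNReal.ofReal (Real.exp (f x)) ∂μ := by
  set c := ∫ x, f x ∂μ with hc
  have hi : Integrable (fun x => Real.exp c * (1 + (f x - c))) μ :=
    (((integrable_const (1 : ℝ)).add (hf.sub (integrable_const c)))).const_mul _
  have h1 : ∫ x, Real.exp c * (1 + (f x - c)) ∂μ = Real.exp c := by
    have h2 : ∫ x, (1 + (f x - c)) ∂μ = ∫ x, (1 : ℝ) ∂μ + ∫ x, (f x - c) ∂μ :=
      integral_add (integrable_const _) (hf.sub (integrable_const c))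
    rw [integral_const_mul, h2, integral_sub hf (integrable_const c)]
    simp [← hc]
  calc ENNReal.ofReal (Real.exp c)
      = ENNReal.ofReal (∫ x, Real.exp c * (1 + (f x - c)) ∂μ) := by rw [h1]
    _ ≤ ∫⁻ x, ENNReal.ofReal (Real.exp c * (1 + (f x - c))) ∂μ :=
        ofReal_integral_le_lintegral_ofReal hi
    _ ≤ _ := by
        refine lintegral_mono fun x => ENNReal.ofReal_le_ofReal ?_
        have := Real.add_one_le_exp (f x - c)
        calc Real.exp c * (1 + (f x - c)) ≤ Real.exp c * Real.exp (f x - c) := by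
              gcongr; linarith
          _ = Real.exp (f x) := by rw [← Real.exp_add]; ring_nf

/-! ### Distribution functions and bounded densities on the line -/

/-- A finite measure on the line whose increments are bounded by those of `M` times Lebesgue
measure is bounded by `M` times Lebesgue measure. -/
lemma le_smul_volume_of_Ioc (ν : Measure ℝ) [IsProbabilityMeasure ν] (M : ℝ≥0)
    (h : ∀ a b, a ≤ b → ν (Set.Ioc a b) ≤ ENNReal.ofReal (M * (b - a))) :
    ν ≤ M • (volume : Measure ℝ) := by
  have hinc : ∀ a b, a ≤ b → cdf ν b - cdf ν a ≤ M * (b - a) := by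
    intro a b hab
    have h1 := h a b hab
    rw [← measure_cdf ν, StieltjesFunction.measure_Ioc] at h1
    exact (ENNReal.ofReal_le_ofReal_iff (mul_nonneg M.2 (sub_nonneg.2 hab))).1 h1
  -- The increment bound says exactly that `M * x - cdf ν x` is nondecreasing; its Stieltjes measure
  -- is what must be added to `ν` to reach `M • volume`.
  let f : StieltjesFunction ℝ :=
    { toFun := fun x => M * x - cdf ν x
      mono' := fun a b hab => by
        have := hinc a b hab
        simp only
        linarith
      right_continuous' := fun x =>
        (continuous_const.mul continuous_id).continuousWithinAt.sub ((cdf ν).right_continuous x) }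
  have hf : f + cdf ν = M • StieltjesFunction.id := by
    ext x
    change (M * x - cdf ν x) + cdf ν x = M * x
    ring
  have hm : f.measure + ν = M • (volume : Measure ℝ) := by
    rw [Real.volume_eq_stieltjes_id, ← StieltjesFunction.measure_smul, ← hf,
      StieltjesFunction.measure_add, measure_cdf]
  rw [← hm]
  exact Measure.le_add_left le_rfl

/-- The mass of a set under an atomless probability measure is at most the oscillation of the
distribution function on that set. -/
lemma measure_le_of_cdf_sub_le (m : Measure ℝ) [IsProbabilityMeasure m] [NullSingletonClass m]
    {B : Set ℝ}
    (hB : MeasurableSet B) {D : ℝ} (h : ∀ x ∈ B, ∀ y ∈ B, x ≤ y → cdf m y - cdf m x ≤ D) :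
    m B ≤ ENNReal.ofReal D := by
  -- By inner regularity `B` may be replaced by a compact subset, whose least and greatest elements
  -- belong to `B`.
  rw [hB.measure_eq_iSup_isCompact]
  refine iSup_le fun K => iSup_le fun hKB => iSup_le fun hK => ?_
  rcases K.eq_empty_or_nonempty with rfl | hne
  · simp
  obtain ⟨x, hx⟩ := hK.exists_isLeast hne
  obtain ⟨y, hy⟩ := hK.exists_isGreatest hne
  calc m K ≤ m (Set.Icc x y) := measure_mono fun z hz => ⟨hx.2 hz, hy.2 hz⟩
    _ = m (Set.Ioc x y) := (measure_congr Ioc_ae_eq_Icc).symm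
    _ = ENNReal.ofReal (cdf m y - cdf m x) := by
        conv_lhs => rw [← measure_cdf m]
        rw [StieltjesFunction.measure_Ioc]
    _ ≤ ENNReal.ofReal D :=
        ENNReal.ofReal_le_ofReal (h x (hKB hx.1) y (hKB hy.1) (hx.2 hy.1))

/-! ### The power map on the interval -/

lemma strictMono_pow_coe {S : Set ℝ} {γ : ℕ} (hγ : 1 ≤ γ) (hS : Even γ → S ⊆ Set.Ici 0) :
    StrictMono fun x : S => (x : ℝ) ^ γ := by
  intro x y hxy
  have hxy : (x : ℝ) < y := hxy
  rcases Nat.even_or_odd γ with h | h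
  · exact pow_lt_pow_left₀ hxy (hS h x.2) (by omega)
  · exact h.strictMono_pow hxy

lemma isClosedEmbedding_pow_coe {S : Set ℝ} (hc : IsClosed S) {γ : ℕ} (hγ : 1 ≤ γ)
    (hS : Even γ → S ⊆ Set.Ici 0) : IsClosedEmbedding fun x : S => (x : ℝ) ^ γ := by
  have hcont : Continuous fun x : S => (x : ℝ) ^ γ := by fun_prop
  refine IsClosedEmbedding.of_continuous_injective_isClosedMap hcont
    (strictMono_pow_coe hγ hS).injective ?_
  refine (isProperMap_iff_isCompact_preimage.2 ⟨hcont, fun K hK => ?_⟩).isClosedMap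
  obtain ⟨R, hR⟩ := hK.isBounded.exists_norm_le
  rw [hc.isClosedEmbedding_subtypeVal.isInducing.isCompact_iff]
  have hclosed : IsClosed (Subtype.val '' ((fun x : S => (x : ℝ) ^ γ) ⁻¹' K)) :=
    hc.isClosedEmbedding_subtypeVal.isClosedMap _ (hK.isClosed.preimage hcont)
  refine Metric.isCompact_of_isClosed_isBounded hclosed ?_
  -- The bound `max 1 R` works because `|x| ≤ |x| ^ γ` as soon as `|x| ≥ 1`.
  refine (Metric.isBounded_Icc (-(max 1 R)) (max 1 R)).subset ?_
  rintro _ ⟨x, hx, rfl⟩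
  have h1 : |(x : ℝ)| ^ γ ≤ R := by
    have := hR _ hx
    rwa [Real.norm_eq_abs, abs_pow] at this
  rw [Set.mem_Icc, ← abs_le]
  by_contra! h
  have h2 : 1 ≤ |(x : ℝ)| := (le_max_left _ _).trans h.le
  have h3 : |(x : ℝ)| ≤ |(x : ℝ)| ^ γ := le_self_pow₀ h2 (by omega)
  exact absurd (h3.trans h1) (not_le.2 ((le_max_right _ _).trans_lt h))

lemma ordConnected_range_pow_coe {S : Set ℝ} (hi : S.OrdConnected) (γ : ℕ) :
    (Set.range fun x : S => (x : ℝ) ^ γ).OrdConnected := by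
  have : PreconnectedSpace S := Subtype.preconnectedSpace hi.isPreconnected
  exact (isPreconnected_range (by fun_prop)).ordConnected

/-! ### Normalized distance and rescaled weight -/

/-- The distance `|x ^ γ - y ^ γ|`, normalized to take values in `[0, 1]`. -/
noncomputable def normDist {S : Set ℝ} (γ : ℕ) (x y : S) : ℝ :=
  |(x : ℝ) ^ γ - (y : ℝ) ^ γ| / ((1 + |(x : ℝ)|) ^ γ * (1 + |(y : ℝ)|) ^ γ)

/-- The logarithmic growth function `log (1 + |x|)`. -/
noncomputable def growth {S : Set ℝ} (x : S) : ℝ := Real.log (1 + |(x : ℝ)|)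

/-- The weight `v`, multiplied by `(1 + |x|) ^ a / C`. -/
noncomputable def scaled {S : Set ℝ} (a C : ℝ) (v : S → ℝ) (x : S) : ℝ :=
  v x * (1 + |(x : ℝ)|) ^ a / C

section

variable {S : Set ℝ}

lemma one_add_abs_pos (x : S) : 0 < 1 + |(x : ℝ)| := by positivity

lemma growth_nonneg (x : S) : 0 ≤ growth x :=
  Real.log_nonneg (by linarith [abs_nonneg (x : ℝ)])

lemma continuous_growth : Continuous (growth : S → ℝ) :=
  Continuous.log (by fun_prop) fun x => (one_add_abs_pos x).ne'

lemma normDist_comm (γ : ℕ) (x y : S) : normDist γ x y = normDist γ y x := by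
  unfold normDist
  rw [abs_sub_comm, mul_comm]

lemma normDist_nonneg (γ : ℕ) (x y : S) : 0 ≤ normDist γ x y := by
  unfold normDist; positivity

lemma normDist_le_one (γ : ℕ) (x y : S) : normDist γ x y ≤ 1 := by
  unfold normDist
  rw [div_le_one (by positivity)]
  have hx : |(x : ℝ)| ^ γ ≤ (1 + |(x : ℝ)|) ^ γ := by gcongr; linarith
  have hy : |(y : ℝ)| ^ γ ≤ (1 + |(y : ℝ)|) ^ γ := by gcongr; linarith
  have hx1 : 1 ≤ (1 + |(x : ℝ)|) ^ γ := one_le_pow₀ (by linarith [abs_nonneg (x : ℝ)])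
  have hy1 : 1 ≤ (1 + |(y : ℝ)|) ^ γ := one_le_pow₀ (by linarith [abs_nonneg (y : ℝ)])
  rcases Nat.eq_zero_or_pos γ with rfl | hγ
  · simp
  -- Superadditivity of the power, together with `s + t ≤ (s + 1) * (t + 1)` for `s, t ≥ 0`, bounds
  -- the numerator by the denominator.
  have hx2 : |(x : ℝ)| ^ γ + 1 ≤ (1 + |(x : ℝ)|) ^ γ := by
    have := pow_add_pow_le (abs_nonneg (x : ℝ)) (zero_le_one) hγ.ne'
    rw [one_pow] at this
    rwa [add_comm 1]
  have h : |(x : ℝ) ^ γ - (y : ℝ) ^ γ| ≤ |(x : ℝ)| ^ γ + |(y : ℝ)| ^ γ := by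
    rw [← abs_pow, ← abs_pow]; exact abs_sub _ _
  have hx0 : 0 ≤ |(x : ℝ)| ^ γ := by positivity
  nlinarith

lemma continuous_normDist (γ : ℕ) : Continuous fun z : S × S => normDist γ z.1 z.2 := by
  unfold normDist
  refine Continuous.div (by fun_prop) (by fun_prop) fun z => ?_
  positivity

lemma normDist_pos {γ : ℕ} {x y : S} (h : (x : ℝ) ^ γ ≠ (y : ℝ) ^ γ) : 0 < normDist γ x y := by
  unfold normDist
  have := abs_pos.2 (sub_ne_zero.2 h)
  positivity

lemma log_abs_sub_eq {γ : ℕ} {x y : S} (h : (x : ℝ) ^ γ ≠ (y : ℝ) ^ γ) :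
    Real.log |(x : ℝ) ^ γ - (y : ℝ) ^ γ|
      = Real.log (normDist γ x y) + γ * (growth x + growth y) := by
  unfold normDist growth
  have h1 := abs_pos.2 (sub_ne_zero.2 h)
  have hx := one_add_abs_pos x
  have hy := one_add_abs_pos y
  rw [Real.log_div h1.ne' (by positivity), Real.log_mul (by positivity) (by positivity),
    Real.log_pow, Real.log_pow]
  ring

lemma scaled_nonneg {a C : ℝ} (hC : 0 < C) {v : S → ℝ} {x : S} (h : 0 ≤ v x) :
    0 ≤ scaled a C v x := by
  unfold scaled; positivity

lemma scaled_pos {a C : ℝ} (hC : 0 < C) {v : S → ℝ} {x : S} (h : 0 < v x) :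
    0 < scaled a C v x := by
  have := one_add_abs_pos x
  unfold scaled; positivity

lemma continuous_scaled {a C : ℝ} {v : S → ℝ} (hv : Continuous v) :
    Continuous (scaled a C v) := by
  unfold scaled
  refine (hv.mul ?_).div_const _
  exact Continuous.rpow_const (by fun_prop) fun x => Or.inl (one_add_abs_pos x).ne'

lemma log_eq_log_scaled {a C : ℝ} (hC : 0 < C) {v : S → ℝ} {x : S} (h : 0 < v x) :
    Real.log (v x) = Real.log (scaled a C v x) - a * growth x + Real.log C := by
  have hx := one_add_abs_pos x
  unfold scaled growth
  rw [Real.log_div (by positivity) hC.ne', Real.log_mul h.ne' (by positivity), Real.log_rpow hx]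
  ring

/-- The uniform control on the weights that follows from the two assumptions. -/
structure ScaledWeights (wn : ℕ → S → ℝ) (w : S → ℝ) (a C : ℝ) : Prop where
  one_le : 1 ≤ C
  limit_le_one : ∀ x, scaled a C w x ≤ 1
  le_one : ∀ᶠ n in atTop, ∀ x, scaled a C (wn n) x ≤ 1
  le_add : ∀ ζ > 0, ∀ᶠ n in atTop, ∀ x, scaled a C (wn n) x ≤ scaled a C w x + ζ

/-- This puts the decay assumption in terms of `1 + |x|`, with the exponent `γκβ + ε` that the pair
interaction consumes. For bounded `S` the tail is empty and any `ε` serves. -/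
lemma exists_tail_bound {wn : ℕ → S → ℝ} (hnn : ∀ n x, 0 ≤ wn n x)
    {β κ : ℝ} (hβ : 0 < β) (hκ : 0 < κ) {γ : ℕ} (ha2 : WeightDecay β κ γ wn) :
    ∃ ε > 0, ∀ ζ > 0, ∃ R : ℝ, ∀ᶠ n in atTop, ∀ x : S, R < |(x : ℝ)| →
      wn n x * (1 + |(x : ℝ)|) ^ (γ * κ * β + ε) ≤ ζ := by
  by_cases hb : Bornology.IsBounded S
  · obtain ⟨R, hR⟩ := hb.exists_norm_le
    exact ⟨1, one_pos, fun ζ _ => ⟨R, Eventually.of_forall fun n x hx =>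
      absurd (hR x x.2) (not_le.2 hx)⟩⟩
  obtain ⟨n₀, ε, hε, h⟩ := ha2 hb
  refine ⟨ε, hε, fun ζ hζ => ?_⟩
  set a := γ * κ * β + ε with ha
  have ha0 : 0 ≤ a := by positivity
  have h2a : (0 : ℝ) < ((2 : ℝ) ^ a)⁻¹ * ζ := by positivity
  have h1 := h.eventually (gt_mem_nhds (ENNReal.ofReal_pos.2 h2a))
  rw [eventually_comap] at h1
  obtain ⟨R, hR⟩ := eventually_atTop.1 h1
  refine ⟨max 1 R, ?_⟩
  filter_upwards [eventually_ge_atTop n₀] with n hn x hx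
  have hx1 : 1 ≤ |(x : ℝ)| := ((le_max_left _ _).trans_lt hx).le
  have hxR : R ≤ |(x : ℝ)| := ((le_max_right _ _).trans_lt hx).le
  have h3 := hR _ hxR x rfl
  have h4 : ENNReal.ofReal (wn n x) ≤ ⨆ n ≥ n₀, ENNReal.ofReal (wn n x) :=
    le_iSup₂_of_le n hn le_rfl
  have h5 : ENNReal.ofReal (|(x : ℝ)| ^ (γ * κ * max β 1 + ε)) * ENNReal.ofReal (wn n x)
      ≤ ENNReal.ofReal (((2 : ℝ) ^ a)⁻¹ * ζ) := by
    refine le_trans ?_ h3.le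
    gcongr
  rw [← ENNReal.ofReal_mul (by positivity), ENNReal.ofReal_le_ofReal_iff h2a.le] at h5
  have h6 : |(x : ℝ)| ^ a ≤ |(x : ℝ)| ^ (γ * κ * max β 1 + ε) := by
    refine Real.rpow_le_rpow_of_exponent_le hx1 ?_
    rw [ha]
    gcongr
    exact le_max_left _ _
  have h7 : (1 + |(x : ℝ)|) ^ a ≤ 2 ^ a * |(x : ℝ)| ^ a := by
    rw [← Real.mul_rpow (by norm_num) (abs_nonneg _)]
    refine Real.rpow_le_rpow (by positivity) (by linarith) ha0
  calc wn n x * (1 + |(x : ℝ)|) ^ a ≤ wn n x * (2 ^ a * |(x : ℝ)| ^ (γ * κ * max β 1 + ε)) := by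
        gcongr
        · exact hnn n x
        · exact h7.trans (by gcongr)
    _ = 2 ^ a * (|(x : ℝ)| ^ (γ * κ * max β 1 + ε) * wn n x) := by ring
    _ ≤ 2 ^ a * (((2 : ℝ) ^ a)⁻¹ * ζ) := by gcongr
    _ = ζ := mul_inv_cancel_left₀ (by positivity) _

/-- Uniform convergence on a compact set is combined with uniform smallness of `wn` outside it. Only
upper bounds for `wn` in terms of `w` come out globally; near the zeros of `w`, where the logarithms
may diverge, nothing more is needed. -/
lemma exists_scaledWeights (hS : IsClosed S) {wn : ℕ → S → ℝ} (hnn : ∀ n x, 0 ≤ wn n x)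
    {w : S → ℝ} (ha1 : WeightLimit wn w)
    {β κ : ℝ} (hβ : 0 < β) (hκ : 0 < κ) {γ : ℕ} (ha2 : WeightDecay β κ γ wn) :
    ∃ ε > 0, ∃ C, ScaledWeights wn w (γ * κ * β + ε) C := by
  obtain ⟨ε, hε, h⟩ := exists_tail_bound hnn hβ hκ ha2
  refine ⟨ε, hε, ?_⟩
  set a := γ * κ * β + ε with ha
  have ha0 : 0 ≤ a := by positivity
  have hpt : ∀ x, Tendsto (fun n => wn n x) atTop (𝓝 (w x)) := fun x =>
    (ha1.tendsto {x} isCompact_singleton).tendsto_at rfl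
  have hK : ∀ R : ℝ, IsCompact {x : S | |(x : ℝ)| ≤ R} := by
    intro R
    have : {x : S | |(x : ℝ)| ≤ R} = Subtype.val ⁻¹' (Set.Icc (-R) R) := by
      ext x; simp [abs_le]
    rw [this]
    exact hS.isClosedEmbedding_subtypeVal.isCompact_preimage isCompact_Icc
  have htail : ∀ ζ > 0, ∃ R : ℝ, (∀ᶠ n in atTop, ∀ x : S, R < |(x : ℝ)| →
      wn n x * (1 + |(x : ℝ)|) ^ a ≤ ζ) ∧ ∀ x : S, R < |(x : ℝ)| →
        w x * (1 + |(x : ℝ)|) ^ a ≤ ζ := by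
    intro ζ hζ
    obtain ⟨R, hR⟩ := h ζ hζ
    exact ⟨R, hR, fun x hx =>
      le_of_tendsto ((hpt x).mul_const _) (hR.mono fun n hn => hn x hx)⟩
  have hclose : ∀ ζ > 0, ∀ᶠ n in atTop, ∀ x : S,
      wn n x * (1 + |(x : ℝ)|) ^ a ≤ w x * (1 + |(x : ℝ)|) ^ a + ζ := by
    intro ζ hζ
    obtain ⟨R, hR, -⟩ := htail ζ hζ
    have hR0 : 0 < (1 + |R|) ^ a := by positivity
    have hu := Metric.tendstoUniformlyOn_iff.1 (ha1.tendsto _ (hK R)) (ζ / (1 + |R|) ^ a)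
      (by positivity)
    filter_upwards [hR, hu] with n h1 h2 x
    by_cases hx : |(x : ℝ)| ≤ R
    · have h3 := h2 x hx
      rw [Real.dist_eq, abs_lt] at h3
      have h4 : (1 + |(x : ℝ)|) ^ a ≤ (1 + |R|) ^ a :=
        Real.rpow_le_rpow (by positivity) (by linarith [le_abs_self R]) ha0
      have h5 : 0 < (1 + |(x : ℝ)|) ^ a := by positivity
      have h6 : (wn n x - w x) * (1 + |(x : ℝ)|) ^ a ≤ ζ := by
        calc (wn n x - w x) * (1 + |(x : ℝ)|) ^ a
            ≤ (ζ / (1 + |R|) ^ a) * (1 + |(x : ℝ)|) ^ a := by gcongr; linarith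
          _ ≤ (ζ / (1 + |R|) ^ a) * (1 + |R|) ^ a := by gcongr
          _ = ζ := div_mul_cancel₀ _ hR0.ne'
      linarith
    · have h3 := h1 x (not_le.1 hx)
      have : 0 ≤ w x * (1 + |(x : ℝ)|) ^ a := mul_nonneg (ha1.nonneg x) (by positivity)
      linarith
  obtain ⟨R, -, hR⟩ := htail 1 one_pos
  have hcont : Continuous fun x : S => w x * (1 + |(x : ℝ)|) ^ a :=
    ha1.continuous.mul (Continuous.rpow_const (by fun_prop) fun x =>
      Or.inl (one_add_abs_pos x).ne')
  obtain ⟨C₀, hC₀⟩ := (hK R).bddAbove_image hcont.continuousOn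
  have hbound : ∀ x : S, w x * (1 + |(x : ℝ)|) ^ a ≤ max 1 C₀ := by
    intro x
    by_cases hx : |(x : ℝ)| ≤ R
    · exact (hC₀ ⟨x, hx, rfl⟩).trans (le_max_right _ _)
    · exact (hR x (not_le.1 hx)).trans (le_max_left _ _)
  -- The extra `1` absorbs the error between `wn` and `w`, so that one constant serves the limit and
  -- all large `n`.
  have hC1 : (1 : ℝ) ≤ max 1 C₀ + 1 := by linarith [le_max_left 1 C₀]
  have hC0 : (0 : ℝ) < max 1 C₀ + 1 := by linarith
  refine ⟨max 1 C₀ + 1, hC1, fun x => ?_, ?_, fun ζ hζ => ?_⟩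
  · unfold scaled
    rw [div_le_one hC0]
    linarith [hbound x]
  · filter_upwards [hclose 1 one_pos] with n hn x
    unfold scaled
    rw [div_le_one hC0]
    linarith [hbound x, hn x]
  · filter_upwards [hclose ζ hζ] with n hn x
    unfold scaled
    have : ζ / (max 1 C₀ + 1) ≤ ζ := div_le_self hζ.le hC1
    calc wn n x * (1 + |(x : ℝ)|) ^ a / (max 1 C₀ + 1)
        ≤ (w x * (1 + |(x : ℝ)|) ^ a + ζ) / (max 1 C₀ + 1) := by gcongr; exact hn x
      _ ≤ _ := by rw [add_div]; linarith

lemma weight_nonneg (β : ℝ) (γ n : ℕ) {v : S → ℝ} (hv : ∀ x, 0 ≤ v x) {m : ℕ} (x : Fin m → S) :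
    0 ≤ weight β γ n v x := by
  unfold weight
  refine mul_nonneg (Finset.prod_nonneg fun i _ => Finset.prod_nonneg fun j _ => ?_)
    (Finset.prod_nonneg fun j _ => pow_nonneg (hv _) _)
  exact Real.rpow_nonneg (abs_nonneg _) _

lemma weight_pos_of {β : ℝ} {γ n : ℕ} {v : S → ℝ} {m : ℕ} {x : Fin m → S}
    (h1 : ∀ i j, i ≠ j → (x i : ℝ) ^ γ ≠ (x j : ℝ) ^ γ) (h2 : ∀ j, 0 < v (x j)) :
    0 < weight β γ n v x := by
  unfold weight
  refine mul_pos (Finset.prod_pos fun i _ => Finset.prod_pos fun j hj => ?_)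
    (Finset.prod_pos fun j _ => pow_pos (h2 _) _)
  exact Real.rpow_pos_of_pos
    (abs_pos.2 (sub_ne_zero.2 (h1 i j (Finset.mem_Ioi.1 hj).ne))) _

lemma log_weight_of {β : ℝ} {γ n : ℕ} {v : S → ℝ} {m : ℕ} {x : Fin m → S}
    (h1 : ∀ i j, i ≠ j → (x i : ℝ) ^ γ ≠ (x j : ℝ) ^ γ) (h2 : ∀ j, 0 < v (x j)) :
    Real.log (weight β γ n v x)
      = β * ∑ i, ∑ j ∈ Finset.Ioi i, Real.log |(x i : ℝ) ^ γ - (x j : ℝ) ^ γ|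
        + n * ∑ j, Real.log (v (x j)) := by
  have hp : ∀ i, ∀ j ∈ Finset.Ioi i, 0 < |(x i : ℝ) ^ γ - (x j : ℝ) ^ γ| := fun i j hj =>
    abs_pos.2 (sub_ne_zero.2 (h1 i j (Finset.mem_Ioi.1 hj).ne))
  unfold weight
  rw [Real.log_mul, Real.log_prod, Real.log_prod, Finset.mul_sum, Finset.mul_sum]
  · congr 1
    · refine Finset.sum_congr rfl fun i _ => ?_
      rw [Real.log_prod, Finset.mul_sum]
      · exact Finset.sum_congr rfl fun j hj => Real.log_rpow (hp i j hj) _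
      · exact fun j hj => (Real.rpow_pos_of_pos (hp i j hj) _).ne'
    · exact Finset.sum_congr rfl fun j _ => Real.log_pow _ _
  · exact fun j _ => (pow_pos (h2 j) _).ne'
  · exact fun i _ => (Finset.prod_pos fun j hj => Real.rpow_pos_of_pos (hp i j hj) _).ne'
  · exact (Finset.prod_pos fun i _ =>
      Finset.prod_pos fun j hj => Real.rpow_pos_of_pos (hp i j hj) _).ne'
  · exact (Finset.prod_pos fun j _ => pow_pos (h2 j) _).ne'

lemma ne_of_weight_pos {β : ℝ} (hβ : 0 < β) {γ n : ℕ} {v : S → ℝ} {m : ℕ} {x : Fin m → S}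
    (h : 0 < weight β γ n v x) : ∀ i j, i ≠ j → (x i : ℝ) ^ γ ≠ (x j : ℝ) ^ γ := by
  have key : ∀ i j, i < j → (x i : ℝ) ^ γ ≠ (x j : ℝ) ^ γ := by
    intro i j hij heq
    refine h.ne' ?_
    unfold weight
    rw [Finset.prod_eq_zero (Finset.mem_univ i), zero_mul]
    rw [Finset.prod_eq_zero (Finset.mem_Ioi.2 hij)]
    rw [heq, sub_self, abs_zero, Real.zero_rpow hβ.ne']
  intro i j hij
  rcases lt_or_gt_of_ne hij with h | h
  · exact key i j h
  · exact (key j i h).symm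

lemma pos_of_weight_pos {β : ℝ} {γ n : ℕ} (hn : n ≠ 0) {v : S → ℝ} (hv : ∀ x, 0 ≤ v x) {m : ℕ}
    {x : Fin m → S} (h : 0 < weight β γ n v x) (j : Fin m) : 0 < v (x j) := by
  refine (hv _).lt_of_ne' fun h0 => h.ne' ?_
  unfold weight
  rw [Finset.prod_eq_zero (f := fun j => v (x j) ^ n) (Finset.mem_univ j), mul_zero]
  simp [h0, hn]

/-- The basic decomposition. For normalized distances and scaled weights at most `1`, the first two
sums are nonnegative. With `a = γκβ + ε` and `m = p n`, the growth coefficient is asymptotic to `n *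
ε`, which confines the points. -/
lemma neg_log_weight_eq {β : ℝ} {γ n : ℕ} {v : S → ℝ} {a C : ℝ} (hC : 0 < C) {m : ℕ}
    {x : Fin m → S} (h1 : ∀ i j, i ≠ j → (x i : ℝ) ^ γ ≠ (x j : ℝ) ^ γ)
    (h2 : ∀ j, 0 < v (x j)) :
    -Real.log (weight β γ n v x)
      = β * ∑ i, ∑ j ∈ Finset.Ioi i, -Real.log (normDist γ (x i) (x j))
        + n * ∑ j, -Real.log (scaled a C v (x j))
        + (n * a - β * γ * (m - 1)) * ∑ j, growth (x j) - n * m * Real.log C := by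
  rw [log_weight_of h1 h2]
  have e1 : ∑ i, ∑ j ∈ Finset.Ioi i, Real.log |(x i : ℝ) ^ γ - (x j : ℝ) ^ γ|
      = ∑ i, ∑ j ∈ Finset.Ioi i, Real.log (normDist γ (x i) (x j))
        + γ * ∑ i, ∑ j ∈ Finset.Ioi i, (growth (x i) + growth (x j)) := by
    simp_rw [Finset.mul_sum, ← Finset.sum_add_distrib]
    exact Finset.sum_congr rfl fun i _ => Finset.sum_congr rfl fun j hj =>
      log_abs_sub_eq (h1 i j (Finset.mem_Ioi.1 hj).ne)
  have e2 := sum_sum_eq_diag_add_two_mul (fun i j => growth (x i) + growth (x j))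
    (fun i j => add_comm _ _)
  have e3 : ∑ i, ∑ j, (growth (x i) + growth (x j)) = 2 * (m * ∑ j, growth (x j)) := by
    simp only [Finset.sum_add_distrib, Finset.sum_const, Finset.card_univ, Fintype.card_fin,
      nsmul_eq_mul, ← Finset.mul_sum]
    ring
  have e4 : ∑ i, (growth (x i) + growth (x i)) = 2 * ∑ j, growth (x j) := by
    rw [Finset.sum_add_distrib]; ring
  -- Each point belongs to `m - 1` pairs.
  have e5 : ∑ i, ∑ j ∈ Finset.Ioi i, (growth (x i) + growth (x j))
      = (m - 1) * ∑ j, growth (x j) := by linarith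
  have e6 : ∑ j, Real.log (v (x j))
      = ∑ j, Real.log (scaled a C v (x j)) - a * ∑ j, growth (x j) + m * Real.log C := by
    rw [Finset.sum_congr rfl fun j _ => log_eq_log_scaled (a := a) hC (h2 j)]
    simp only [Finset.sum_add_distrib, Finset.sum_sub_distrib, Finset.sum_const, Finset.card_univ,
      Fintype.card_fin, nsmul_eq_mul, ← Finset.mul_sum]
  rw [e1, e5, e6]
  simp only [Finset.sum_neg_distrib]
  ring

lemma measurable_weight (β : ℝ) (γ n : ℕ) {v : S → ℝ} (hv : Continuous v) {m : ℕ} :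
    Measurable fun x : Fin m → S => weight β γ n v x := by
  unfold weight
  refine Measurable.mul ?_ ?_
  · refine Finset.measurable_prod _ fun i _ => Finset.measurable_prod _ fun j _ => ?_
    have : Measurable fun x : Fin m → S => |(x i : ℝ) ^ γ - (x j : ℝ) ^ γ| := by fun_prop
    exact this.pow_const _
  · refine Finset.measurable_prod _ fun j _ => ?_
    exact (hv.measurable.comp (measurable_pi_apply j)).pow_const _

end

/-! ### The energy as a nonnegative integral minus a constant -/

lemma ereal_sub_eq_of_add_eq {P N G : ℝ≥0∞} {B : ℝ} (hB : 0 ≤ B) (hN : N ≠ ∞)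
    (h : P + ENNReal.ofReal B = G + N) : (P : EReal) - N = G - (B : ℝ) := by
  lift N to ℝ≥0 using hN
  induction P with
  | top =>
    have hG : G = ⊤ := by
      by_contra hG
      rw [top_add] at h
      exact (ENNReal.add_ne_top.2 ⟨hG, ENNReal.coe_ne_top⟩) h.symm
    subst hG
    have h1 : ((N : ℝ≥0∞) : EReal) = ((N : ℝ) : EReal) := rfl
    rw [h1, EReal.coe_ennreal_top, EReal.top_sub_coe, EReal.top_sub_coe]
  | coe P =>
    have hG : G ≠ ⊤ := by
      rintro rfl
      rw [top_add] at h
      exact (ENNReal.add_ne_top.2 ⟨ENNReal.coe_ne_top, ENNReal.ofReal_ne_top⟩) h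
    lift G to ℝ≥0 using hG
    have h2 : (P : ℝ) + B = G + N := by
      have := congrArg ENNReal.toReal h
      rwa [ENNReal.toReal_add ENNReal.coe_ne_top ENNReal.ofReal_ne_top,
        ENNReal.toReal_add ENNReal.coe_ne_top ENNReal.coe_ne_top, ENNReal.toReal_ofReal hB] at this
    have e : ∀ x : ℝ≥0, ((x : ℝ≥0∞) : EReal) = ((x : ℝ) : EReal) := fun _ => rfl
    rw [e, e, e, ← EReal.coe_sub, ← EReal.coe_sub, EReal.coe_eq_coe_iff]
    linarith

/-- For `f = g - B` with `g, B ≥ 0` the parts satisfy `f⁺ + B = g + f⁻` and `f⁻ ≤ B`. Integrating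
this identity in `[0, ∞]` avoids any difference of infinities, even when `∫ g = ∞`. -/
lemma erealIntegral_eq_sub {X : Type*} [MeasurableSpace X] (μ : Measure X)
    [IsProbabilityMeasure μ] {f : X → EReal} {g : X → ℝ≥0∞} (hg : Measurable g) {B : ℝ}
    (hB : 0 ≤ B) (h : ∀ x, f x = (g x : EReal) - (B : ℝ)) :
    erealIntegral μ f = ((∫⁻ x, g x ∂μ : ℝ≥0∞) : EReal) - (B : ℝ) := by
  have hpt : ∀ x, (f x).toENNReal + ENNReal.ofReal B = g x + (-f x).toENNReal ∧
      (-f x).toENNReal ≤ ENNReal.ofReal B := by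
    intro x
    rw [h x]
    induction g x with
    | top => simp
    | coe r =>
      have e : ((r : ℝ≥0∞) : EReal) = ((r : ℝ) : EReal) := rfl
      have e2 : (r : ℝ≥0∞) = ENNReal.ofReal r := (ENNReal.ofReal_coe_nnreal).symm
      rw [e, ← EReal.coe_sub, ← EReal.coe_neg, EReal.toENNReal_of_ne_top (EReal.coe_ne_top _),
        EReal.toENNReal_of_ne_top (EReal.coe_ne_top _), EReal.toReal_coe, EReal.toReal_coe, e2]
      have hr : (0 : ℝ) ≤ r := r.2
      refine ⟨?_, ENNReal.ofReal_le_ofReal (by linarith)⟩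
      rcases le_total B r with hBr | hBr
      · rw [ENNReal.ofReal_of_nonpos (p := -(r - B)) (by linarith), add_zero,
          ← ENNReal.ofReal_add (by linarith) hB]
        congr 1; ring
      · rw [ENNReal.ofReal_of_nonpos (p := r - B) (by linarith), zero_add,
          ← ENNReal.ofReal_add hr (by linarith)]
        congr 1; ring
  unfold erealIntegral
  refine ereal_sub_eq_of_add_eq hB ?_ ?_
  · refine ne_top_of_le_ne_top (b := ENNReal.ofReal B) ENNReal.ofReal_ne_top ?_
    calc _ ≤ ∫⁻ _, ENNReal.ofReal B ∂μ := lintegral_mono fun x => (hpt x).2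
      _ = _ := by simp
  · rw [← lintegral_add_left hg, ← lintegral_congr fun x => (hpt x).1,
      lintegral_add_right _ measurable_const]
    simp

variable {S : Set ℝ}

/-- The real-valued nonnegative expression that differs from the kernel by a constant, where the
kernel is finite. -/
noncomputable def excessReal (β κ : ℝ) (γ : ℕ) (ε C : ℝ) (w : S → ℝ) (z : S × S) : ℝ :=
  β / 2 * κ ^ 2 * -Real.log (normDist γ z.1 z.2)
    + κ / 2 * (-Real.log (scaled (γ * κ * β + ε) C w z.1)
      + -Real.log (scaled (γ * κ * β + ε) C w z.2))
    + κ * ε / 2 * (growth z.1 + growth z.2)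

open Classical in
/-- The kernel plus the constant `κ log C`, with values in `[0, ∞]`. -/
noncomputable def excess (β κ : ℝ) (γ : ℕ) (ε C : ℝ) (w : S → ℝ) (z : S × S) : ℝ≥0∞ :=
  if (z.1 : ℝ) ^ γ = (z.2 : ℝ) ^ γ ∨ w z.1 = 0 ∨ w z.2 = 0 then ⊤
  else ENNReal.ofReal (excessReal β κ γ ε C w z)

lemma neg_log_nonneg {t : ℝ} (h0 : 0 ≤ t) (h1 : t ≤ 1) : 0 ≤ -Real.log t :=
  neg_nonneg.2 (Real.log_nonpos h0 h1)

lemma excessReal_nonneg {β κ : ℝ} (hβ : 0 < β) (hκ : 0 < κ) (γ : ℕ) {ε C : ℝ} (hε : 0 < ε)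
    (hC : 0 < C) {w : S → ℝ} (hw : ∀ x, 0 ≤ w x) (hq : ∀ x, scaled (γ * κ * β + ε) C w x ≤ 1)
    (z : S × S) : 0 ≤ excessReal β κ γ ε C w z := by
  have h1 := neg_log_nonneg (normDist_nonneg γ z.1 z.2) (normDist_le_one γ z.1 z.2)
  have h2 := neg_log_nonneg (scaled_nonneg hC (hw z.1)) (hq z.1)
  have h3 := neg_log_nonneg (scaled_nonneg hC (hw z.2)) (hq z.2)
  have h4 := growth_nonneg z.1
  have h5 := growth_nonneg z.2
  unfold excessReal
  positivity

lemma measurable_excessReal (β κ : ℝ) (γ : ℕ) (ε C : ℝ) {w : S → ℝ} (hw : Continuous w) :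
    Measurable (excessReal β κ γ ε C w) := by
  have h1 := (continuous_normDist (S := S) γ).measurable
  have h2 := (continuous_scaled (a := γ * κ * β + ε) (C := C) hw).measurable
  have h3 := (continuous_growth (S := S)).measurable
  unfold excessReal
  exact ((h1.log.neg.const_mul _).add
    (((h2.comp measurable_fst).log.neg.add (h2.comp measurable_snd).log.neg).const_mul _)).add
    (((h3.comp measurable_fst).add (h3.comp measurable_snd)).const_mul _)

lemma measurableSet_singular (γ : ℕ) {w : S → ℝ} (hw : Continuous w) :
    MeasurableSet {z : S × S | (z.1 : ℝ) ^ γ = (z.2 : ℝ) ^ γ ∨ w z.1 = 0 ∨ w z.2 = 0} := by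
  refine IsClosed.measurableSet ?_
  exact (isClosed_eq (by fun_prop) (by fun_prop)).union
    ((isClosed_eq (hw.comp continuous_fst) continuous_const).union
      (isClosed_eq (hw.comp continuous_snd) continuous_const))

lemma measurable_excess (β κ : ℝ) (γ : ℕ) (ε C : ℝ) {w : S → ℝ} (hw : Continuous w) :
    Measurable (excess β κ γ ε C w) := by
  unfold excess
  exact Measurable.ite (measurableSet_singular γ hw) measurable_const
    (measurable_excessReal β κ γ ε C hw).ennreal_ofReal

lemma excessReal_eq {β κ : ℝ} {γ : ℕ} {ε C : ℝ} (hC : 0 < C) {w : S → ℝ} (hw : ∀ x, 0 ≤ w x)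
    {z : S × S} (hz : ¬((z.1 : ℝ) ^ γ = (z.2 : ℝ) ^ γ ∨ w z.1 = 0 ∨ w z.2 = 0)) :
    excessReal β κ γ ε C w z = β / 2 * κ ^ 2 * -Real.log |(z.1 : ℝ) ^ γ - (z.2 : ℝ) ^ γ|
      - κ / 2 * (Real.log (w z.1) + Real.log (w z.2)) + κ * Real.log C := by
  push Not at hz
  obtain ⟨h1, h2, h3⟩ := hz
  rw [log_abs_sub_eq h1, log_eq_log_scaled (a := γ * κ * β + ε) hC ((hw _).lt_of_ne' h2),
    log_eq_log_scaled (a := γ * κ * β + ε) hC ((hw _).lt_of_ne' h3)]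
  unfold excessReal
  ring

lemma kernel_eq {β κ : ℝ} (hβ : 0 < β) (hκ : 0 < κ) {γ : ℕ} {ε C : ℝ} (hε : 0 < ε)
    (hC : 0 < C) {w : S → ℝ} (hw : ∀ x, 0 ≤ w x) (hq : ∀ x, scaled (γ * κ * β + ε) C w x ≤ 1)
    (z : S × S) :
    kernel β κ γ w z = (excess β κ γ ε C w z : EReal) - ((κ * Real.log C : ℝ) : EReal) := by
  unfold kernel excess
  split_ifs with h
  · rw [EReal.coe_ennreal_top, EReal.top_sub_coe]
  · rw [EReal.coe_ennreal_ofReal, max_eq_left (excessReal_nonneg hβ hκ γ hε hC hw hq z),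
      ← EReal.coe_sub, excessReal_eq hC hw h, Real.log_inv]
    congr 1; ring

lemma energy_eq {β κ : ℝ} (hβ : 0 < β) (hκ : 0 < κ) {γ : ℕ} {ε C : ℝ} (hε : 0 < ε)
    (hC : 1 ≤ C) {w : S → ℝ} (hwc : Continuous w) (hw : ∀ x, 0 ≤ w x)
    (hq : ∀ x, scaled (γ * κ * β + ε) C w x ≤ 1) (μ : ProbabilityMeasure S) :
    energy β κ γ w μ
      = ((∫⁻ z, excess β κ γ ε C w z ∂((μ : Measure S).prod (μ : Measure S)) : ℝ≥0∞) : EReal)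
        - ((κ * Real.log C : ℝ) : EReal) :=
  erealIntegral_eq_sub _ (measurable_excess β κ γ ε C hwc)
    (mul_nonneg hκ.le (Real.log_nonneg hC))
    (kernel_eq hβ hκ hε (zero_lt_one.trans_le hC) hw hq)

lemma coe_ennreal_sub_coe_ne_bot (G : ℝ≥0∞) (B : ℝ) : (G : EReal) - (B : EReal) ≠ ⊥ := by
  induction G with
  | top => simp
  | coe r =>
    have e : ((r : ℝ≥0∞) : EReal) = ((r : ℝ) : EReal) := rfl
    rw [e, ← EReal.coe_sub]
    exact EReal.coe_ne_bot _

/-- On a space with at least two points, the unique minimizer of an energy plus a constant has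
finite energy, and it is the only one with at most that energy. -/
lemma exists_energy_eq_coe {X : Type*} [MeasurableSpace X] [TopologicalSpace X]
    [OpensMeasurableSpace X] [T0Space X] [Nontrivial X] {J : ProbabilityMeasure X → EReal}
    (hJ : ∀ μ, J μ ≠ ⊥) {c : EReal} {μs : ProbabilityMeasure X}
    (h : IsUniqueMinimizer (fun μ => J μ + c) μs) :
    ∃ E : ℝ, J μs = E ∧ ∀ μ, J μ ≤ E → μ = μs := by
  obtain ⟨hmin, huniq⟩ := h
  -- A constant function would have two distinct Dirac masses among its minimizers. This excludes `c
  -- = ⊥`, `c = ⊤` and, for finite `c`, an infinite minimum of `J`.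
  have hconst : ¬ ∀ μ ν, J μ + c ≤ J ν + c := by
    intro hall
    obtain ⟨x, y, hxy⟩ := exists_pair_ne X
    exact hxy (injective_diracProba
      ((huniq _ (hall (diracProba x))).trans (huniq _ (hall (diracProba y))).symm))
  induction c with
  | bot => exact absurd (fun μ ν => by simp) hconst
  | top => exact absurd (fun μ ν => by
      rw [EReal.add_top_of_ne_bot (hJ μ), EReal.add_top_of_ne_bot (hJ ν)]) hconst
  | coe c =>
    have hcancel : ∀ μ ν, J μ + c ≤ J ν + c ↔ J μ ≤ J ν := by
      intro μ ν
      constructor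
      · intro h1
        have := add_le_add_left h1 ((-c : ℝ) : EReal)
        rwa [add_assoc, add_assoc, ← EReal.coe_add, add_neg_cancel, EReal.coe_zero, add_zero,
          add_zero] at this
      · intro h1
        gcongr
    have hle : ∀ ν, J μs ≤ J ν := fun ν => (hcancel _ _).1 (hmin ν)
    have htop : J μs ≠ ⊤ := fun htop => hconst fun μ ν =>
      (hcancel _ _).2 (le_top.trans (htop ▸ hle ν))
    refine ⟨(J μs).toReal, (EReal.coe_toReal htop (hJ μs)).symm, fun μ hμ => huniq μ fun ν => ?_⟩
    rw [EReal.coe_toReal htop (hJ μs)] at hμ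
    exact (hcancel _ _).2 (hμ.trans (hle ν))

/-! ### Lower bound for the partition function by a trial measure -/

lemma sigmaFinite_comap_coe {S : Set ℝ} (hS : MeasurableSet S) :
    SigmaFinite (Measure.comap ((↑) : S → ℝ) volume) := by
  refine SigmaFinite.of_map _ (f := ((↑) : S → ℝ)) measurable_subtype_coe.aemeasurable ?_
  rw [(MeasurableEmbedding.subtype_coe hS).map_comap]
  infer_instance

lemma integrable_of_continuousOn_compact {X : Type*} [TopologicalSpace X] [T2Space X]
    [MeasurableSpace X] [BorelSpace X] {μ : Measure X} [IsFiniteMeasure μ] {K : Set X}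
    (hK : IsCompact K) (hμ : μ Kᶜ = 0) {f : X → ℝ} (hf : ContinuousOn f K) : Integrable f μ := by
  have h := hf.integrableOn_compact (μ := μ) hK
  rwa [IntegrableOn, Measure.restrict_eq_self_of_ae_mem (measure_eq_zero_iff_ae_notMem.1 hμ |>.mono
    fun x hx => not_not.1 hx)] at h

/-- The energy as a combination of two real-valued integrals. -/
noncomputable def realEnergy (β κ : ℝ) (γ : ℕ) (w : S → ℝ) (μ : Measure S) : ℝ :=
  -(β / 2 * κ ^ 2 * ∫ z : S × S, Real.log |(z.1 : ℝ) ^ γ - (z.2 : ℝ) ^ γ| ∂(μ.prod μ))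
    - κ * ∫ x, Real.log (w x) ∂μ

/-- Integrating the weight against Lebesgue measure loses at most the factor `M ^ m` compared with
the product of `ν`. Under that product, Jensen's inequality reduces the logarithm of the weight to
one-point and two-point integrals. The domination of the density replaces an entropy term. -/
lemma exp_le_partitionFunction (hS : IsClosed S) {β : ℝ} {γ n : ℕ} (hγ : 1 ≤ γ)
    (hS0 : Even γ → S ⊆ Set.Ici 0) {v : S → ℝ} (hvc : Continuous v)
    {ν : Measure S} [IsProbabilityMeasure ν]
    {M : ℝ≥0} (hM : 1 ≤ M) (hν : ν ≤ M • Measure.comap ((↑) : S → ℝ) volume) {K : Set S}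
    (hK : IsCompact K) (hvK : ∀ x ∈ K, 0 < v x) (hνK : ν Kᶜ = 0)
    (hint : Integrable (fun z : S × S => Real.log |(z.1 : ℝ) ^ γ - (z.2 : ℝ) ^ γ|) (ν.prod ν))
    (m : ℕ) :
    ENNReal.ofReal (Real.exp (β * (m * (m - 1) / 2) *
        (∫ z : S × S, Real.log |(z.1 : ℝ) ^ γ - (z.2 : ℝ) ^ γ| ∂(ν.prod ν))
        + n * (m * ∫ x, Real.log (v x) ∂ν) - m * Real.log M))
      ≤ partitionFunction β γ n v m := by
  have := sigmaFinite_comap_coe hS.measurableSet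
  have hatom : NullSingletonClass ν := by
    refine ⟨fun x => ?_⟩
    refine le_antisymm ((Measure.le_iff'.1 hν {x}).trans ?_) bot_le
    rw [Measure.smul_apply, (MeasurableEmbedding.subtype_coe hS.measurableSet).comap_apply]
    simp
  set I := ∫ z : S × S, Real.log |(z.1 : ℝ) ^ γ - (z.2 : ℝ) ^ γ| ∂(ν.prod ν)
  set Λ := ∫ x, Real.log (v x) ∂ν
  set π := Measure.pi fun _ : Fin m => ν
  have hlogv : Integrable (fun x => Real.log (v x)) ν :=
    integrable_of_continuousOn_compact hK hνK
      (hvc.continuousOn.log fun x hx => (hvK x hx).ne')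
  have hpair : ∀ i j : Fin m, i ≠ j →
      MeasurePreserving (fun x : Fin m → S => (x i, x j)) π (ν.prod ν) := fun i j hij =>
    ⟨(measurable_pi_apply i).prodMk (measurable_pi_apply j), map_eval_pair_pi ν hij⟩
  have hone : ∀ i : Fin m, MeasurePreserving (fun x : Fin m → S => x i) π ν := fun i =>
    measurePreserving_eval (fun _ : Fin m => ν) i
  have hmeas : Measurable fun z : S × S => Real.log |(z.1 : ℝ) ^ γ - (z.2 : ℝ) ^ γ| := by
    have : Measurable fun z : S × S => |(z.1 : ℝ) ^ γ - (z.2 : ℝ) ^ γ| := by fun_prop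
    exact this.log
  have hi1 : ∀ i, ∀ j ∈ Finset.Ioi i, Integrable
      (fun x : Fin m → S => Real.log |(x i : ℝ) ^ γ - (x j : ℝ) ^ γ|) π := fun i j hj =>
    (hpair i j (Finset.mem_Ioi.1 hj).ne).integrable_comp_of_integrable hint
  have hi2 : ∀ j, Integrable (fun x : Fin m → S => Real.log (v (x j))) π := fun j =>
    (hone j).integrable_comp_of_integrable hlogv
  have he1 : ∀ i, ∀ j ∈ Finset.Ioi i,
      ∫ x : Fin m → S, Real.log |(x i : ℝ) ^ γ - (x j : ℝ) ^ γ| ∂π = I := fun i j hj => by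
    have h := hpair i j (Finset.mem_Ioi.1 hj).ne
    rw [← integral_map h.measurable.aemeasurable (f := fun z : S × S =>
      Real.log |(z.1 : ℝ) ^ γ - (z.2 : ℝ) ^ γ|) hmeas.aestronglyMeasurable, h.map_eq]
  have he2 : ∀ j, ∫ x : Fin m → S, Real.log (v (x j)) ∂π = Λ := fun j => by
    rw [← integral_map (hone j).measurable.aemeasurable (f := fun x : S => Real.log (v x))
      hvc.measurable.log.aestronglyMeasurable, (hone j).map_eq]
  set f : (Fin m → S) → ℝ := fun x =>
    β * ∑ i, ∑ j ∈ Finset.Ioi i, Real.log |(x i : ℝ) ^ γ - (x j : ℝ) ^ γ|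
        + n * ∑ j, Real.log (v (x j)) with hf
  have hfi1 : Integrable (fun x : Fin m → S =>
      ∑ i, ∑ j ∈ Finset.Ioi i, Real.log |(x i : ℝ) ^ γ - (x j : ℝ) ^ γ|) π :=
    integrable_finsetSum _ fun i _ => integrable_finsetSum _ fun j hj => hi1 i j hj
  have hfi2 : Integrable (fun x : Fin m → S => ∑ j, Real.log (v (x j))) π :=
    integrable_finsetSum _ fun j _ => hi2 j
  have hfi : Integrable f π := (hfi1.const_mul _).add (hfi2.const_mul _)
  have hcard : ∑ i : Fin m, ∑ _j ∈ Finset.Ioi i, I = m * (m - 1) / 2 * I := by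
    have h := sum_sum_eq_diag_add_two_mul (m := m) (fun _ _ => I) (fun _ _ => rfl)
    rw [Finset.sum_const, Finset.sum_const, Finset.card_univ, Fintype.card_fin] at h
    simp only [nsmul_eq_mul] at h
    linarith
  have hfint : ∫ x, f x ∂π = β * (m * (m - 1) / 2) * I + n * (m * Λ) := by
    rw [hf, integral_add (hfi1.const_mul _) (hfi2.const_mul _), integral_const_mul,
      integral_const_mul, integral_finsetSum _ fun i _ => integrable_finsetSum _ (hi1 i),
      integral_finsetSum _ fun j _ => hi2 j, Finset.sum_congr rfl fun j _ => he2 j,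
      Finset.sum_congr rfl fun i _ => (integral_finsetSum _ (hi1 i)).trans
        (Finset.sum_congr rfl (he1 i)), hcard]
    simp only [Finset.sum_const, Finset.card_univ, Fintype.card_fin, nsmul_eq_mul]
    ring
  have hdist : ∀ᵐ x ∂π, ∀ i j : Fin m, i ≠ j → (x i : ℝ) ^ γ ≠ (x j : ℝ) ^ γ := by
    rw [ae_all_iff]; intro i; rw [ae_all_iff]; intro j
    by_cases hij : i = j
    · exact Eventually.of_forall fun _ h => absurd hij h
    have h := (hpair i j hij).quasiMeasurePreserving.ae
      (measure_eq_zero_iff_ae_notMem.1 (measure_prod_diag ν))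
    filter_upwards [h] with x hx _ heq
    exact hx ((strictMono_pow_coe hγ hS0).injective heq)
  have hpos : ∀ᵐ x ∂π, ∀ j : Fin m, 0 < v (x j) := by
    rw [ae_all_iff]; intro j
    filter_upwards [(hone j).quasiMeasurePreserving.ae
      (measure_eq_zero_iff_ae_notMem.1 hνK)] with x hx
    exact hvK _ (not_not.1 hx)
  have hM0 : (0 : ℝ) < M := lt_of_lt_of_le one_pos (by exact_mod_cast hM)
  have key : ENNReal.ofReal (Real.exp (∫ x, f x ∂π))
      ≤ ENNReal.ofReal ((M : ℝ) ^ m) * partitionFunction β γ n v m := by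
    calc ENNReal.ofReal (Real.exp (∫ x, f x ∂π))
        ≤ ∫⁻ x, ENNReal.ofReal (Real.exp (f x)) ∂π := ofReal_exp_integral_le_lintegral hfi
      _ = ∫⁻ x, ENNReal.ofReal (weight β γ n v x) ∂π := by
          refine lintegral_congr_ae ?_
          filter_upwards [hdist, hpos] with x h1 h2
          rw [hf]
          simp only
          rw [← log_weight_of h1 h2, Real.exp_log (weight_pos_of h1 h2)]
      _ ≤ ∫⁻ x, ENNReal.ofReal (weight β γ n v x) ∂((M ^ m) • lebesgue S m) :=
          lintegral_mono' (pi_le_smul_pi hν m) le_rfl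
      _ = _ := by
          rw [lintegral_smul_measure]
          unfold partitionFunction
          rw [ENNReal.smul_def, smul_eq_mul, ← ENNReal.ofReal_coe_nnreal, NNReal.coe_pow]
  rw [hfint] at key
  have hMm : (0 : ℝ) < (M : ℝ) ^ m := by positivity
  rw [Real.exp_sub, show (m : ℝ) * Real.log M = Real.log ((M : ℝ) ^ m) by rw [Real.log_pow],
    Real.exp_log hMm, ENNReal.ofReal_div_of_pos hMm]
  exact ENNReal.div_le_of_le_mul' key

lemma tendsto_integral_log_weight {wn : ℕ → S → ℝ} (hwn : ∀ n, Continuous (wn n))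
    {w : S → ℝ} (ha1 : WeightLimit wn w) {ν : Measure S}
    [IsProbabilityMeasure ν] {K : Set S} (hK : IsCompact K) (hKz : Disjoint K {x | w x = 0})
    (hνK : ν Kᶜ = 0) :
    Tendsto (fun n => ∫ x, Real.log (wn n x) ∂ν) atTop (𝓝 (∫ x, Real.log (w x) ∂ν)) := by
  have hint : ∀ v : S → ℝ, Continuous v → (∀ x ∈ K, v x ≠ 0) →
      Integrable (fun x => Real.log (v x)) ν := fun v hv h =>
    integrable_of_continuousOn_compact hK hνK (hv.continuousOn.log h)
  have hw0 : ∀ x ∈ K, w x ≠ 0 := fun x hx h => Set.disjoint_left.1 hKz hx h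
  rw [Metric.tendsto_nhds]
  intro e he
  filter_upwards [ha1.zeros_subset,
    Metric.tendstoUniformlyOn_iff.1 (ha1.tendsto_log K hK hKz) (e / 2) (half_pos he)] with n h1 h2
  have hn0 : ∀ x ∈ K, wn n x ≠ 0 := fun x hx h => hw0 x hx (h1 h)
  rw [Real.dist_eq, ← integral_sub (hint _ (hwn n) hn0) (hint _ ha1.continuous hw0)]
  have h3 : ∀ᵐ x ∂ν, ‖Real.log (wn n x) - Real.log (w x)‖ ≤ e / 2 := by
    filter_upwards [measure_eq_zero_iff_ae_notMem.1 hνK] with x hx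
    have := h2 x (not_not.1 hx)
    rw [dist_comm, Real.dist_eq] at this
    exact this.le
  have h4 := norm_integral_le_of_norm_le_const h3
  rw [probReal_univ, mul_one, Real.norm_eq_abs] at h4
  linarith

/-- The lower bound on the partition function given by a regular trial measure. -/
lemma eventually_exp_realEnergy_le (hS : IsClosed S) {β κ : ℝ} {γ : ℕ} (hγ : 1 ≤ γ)
    (hS0 : Even γ → S ⊆ Set.Ici 0) {p : ℕ → ℕ}
    (hp : Tendsto (fun n : ℕ => (p n : ℝ) / n) atTop (𝓝 κ))
    {wn : ℕ → S → ℝ} (hwn : ∀ n, Continuous (wn n))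
    (hnn : ∀ n x, 0 ≤ wn n x) {w : S → ℝ} (ha1 : WeightLimit wn w) {ν : Measure S}
    [IsProbabilityMeasure ν] {M : ℝ≥0} (hM : 1 ≤ M)
    (hν : ν ≤ M • Measure.comap ((↑) : S → ℝ) volume) {K : Set S}
    (hK : IsCompact K) (hKz : Disjoint K {x | w x = 0}) (hνK : ν Kᶜ = 0)
    (hint : Integrable (fun z : S × S => Real.log |(z.1 : ℝ) ^ γ - (z.2 : ℝ) ^ γ|) (ν.prod ν))
    {e : ℝ} (he : realEnergy β κ γ w ν < e) :
    ∀ᶠ n : ℕ in atTop, ENNReal.ofReal (Real.exp (-((n : ℝ) ^ 2 * e)))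
      ≤ partitionFunction β γ n (wn n) (p n) := by
  set I := ∫ z : S × S, Real.log |(z.1 : ℝ) ^ γ - (z.2 : ℝ) ^ γ| ∂(ν.prod ν) with hI
  have hinv : Tendsto (fun n : ℕ => (1 : ℝ) / n) atTop (𝓝 0) := tendsto_one_div_atTop_nhds_zero_nat
  have hlim : Tendsto (fun n : ℕ => β / 2 * ((p n : ℝ) / n * ((p n : ℝ) / n - 1 / n)) * I
      + (p n : ℝ) / n * (∫ x, Real.log (wn n x) ∂ν) - (p n : ℝ) / n * (1 / n) * Real.log M) atTop
      (𝓝 (-realEnergy β κ γ w ν)) := by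
    have h1 := ((((hp.mul (hp.sub hinv)).const_mul (β / 2)).mul_const I).add
      (hp.mul (tendsto_integral_log_weight hwn ha1 hK hKz hνK))).sub
        ((hp.mul hinv).mul_const (Real.log M))
    convert h1 using 2
    unfold realEnergy
    rw [← hI]
    ring
  filter_upwards [hlim.eventually (lt_mem_nhds (neg_lt_neg he)), ha1.zeros_subset,
    eventually_ge_atTop 1] with n h1 h2 h3
  have hn0 : (0 : ℝ) < n := by exact_mod_cast h3
  refine le_trans (ENNReal.ofReal_le_ofReal (Real.exp_le_exp.2 ?_))
    (exp_le_partitionFunction (β := β) (n := n) hS hγ hS0 (hwn n) hM hν hK (fun x hx =>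
      (hnn n x).lt_of_ne' fun h => Set.disjoint_left.1 hKz hx (h2 h)) hνK hint (p n))
  have h4 := mul_le_mul_of_nonneg_left h1.le (sq_nonneg (n : ℝ))
  calc -((n : ℝ) ^ 2 * e) = (n : ℝ) ^ 2 * -e := by ring
    _ ≤ _ := h4
    _ = _ := by
      rw [← hI]
      field_simp

/-! ### Regularization by a spreading map -/

/-- The increasing map `t ↦ (1 - h) t + h (c + (d - c) G(t))`, for the distribution function `G`
of `m`. It contracts towards `[c, d]` and spreads out the measure `m` at the scale `h`. -/
noncomputable def spread (m : Measure ℝ) (c d h t : ℝ) : ℝ :=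
  (1 - h) * t + h * (c + (d - c) * cdf m t)

lemma measurable_spread (m : Measure ℝ) (c d h : ℝ) : Measurable (spread m c d h) := by
  have := (monotone_cdf m).measurable
  unfold spread
  fun_prop

lemma spread_sub (m : Measure ℝ) (c d h s t : ℝ) :
    spread m c d h t - spread m c d h s = (1 - h) * (t - s) + h * (d - c) * (cdf m t - cdf m s) := by
  unfold spread; ring

/-- Both summands of the spreading map are nondecreasing, so the linear one alone bounds distances
from below. Hence the logarithmic interaction decreases by at most `-log (1 - h)`. -/
lemma abs_spread_sub_ge (m : Measure ℝ) {c d h : ℝ} (hcd : c ≤ d) (h0 : 0 ≤ h)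
    (s t : ℝ) : (1 - h) * |t - s| ≤ |spread m c d h t - spread m c d h s| := by
  rw [spread_sub]
  have h2 : 0 ≤ h * (d - c) := mul_nonneg h0 (sub_nonneg.2 hcd)
  rcases le_total s t with hst | hst
  · have := monotone_cdf m hst
    rw [abs_of_nonneg (sub_nonneg.2 hst)]
    refine le_trans ?_ (le_abs_self _)
    nlinarith
  · have := monotone_cdf m hst
    rw [abs_of_nonpos (sub_nonpos.2 hst)]
    refine le_trans ?_ (neg_le_abs _)
    nlinarith

/-- Here the other summand is kept: an interval of mass `q` is stretched to length at least `h * (d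
- c) * q`, which bounds the density of the image. -/
lemma cdf_sub_le_spread_sub (m : Measure ℝ) {c d h : ℝ} (h1 : h ≤ 1) {s t : ℝ} (hst : s ≤ t) :
    h * (d - c) * (cdf m t - cdf m s) ≤ spread m c d h t - spread m c d h s := by
  rw [spread_sub]
  nlinarith

lemma spread_mem {m : Measure ℝ} {T : Set ℝ} (hT : T.OrdConnected) {c d h t : ℝ} (hc : c ∈ T)
    (hd : d ∈ T) (ht : t ∈ T) (hcd : c ≤ d) (h0 : 0 ≤ h) (h1 : h ≤ 1) :
    spread m c d h t ∈ T := by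
  have hmem : c + (d - c) * cdf m t ∈ T := by
    refine hT.out hc hd ⟨?_, ?_⟩
    · nlinarith [cdf_nonneg m t]
    · nlinarith [cdf_le_one m t]
  exact hT.convex ht hmem (sub_nonneg.2 h1) h0 (by ring)

lemma abs_spread_sub_self_le (m : Measure ℝ) {c d h t T : ℝ} (hcd : c ≤ d) (h0 : 0 ≤ h)
    (ht : |t| ≤ T) : |spread m c d h t - t| ≤ h * (|c| + (d - c) + T) := by
  have e : spread m c d h t - t = h * (c + (d - c) * cdf m t - t) := by unfold spread; ring
  rw [e, abs_mul, abs_of_nonneg h0]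
  gcongr
  have h2 : |(d - c) * cdf m t| ≤ d - c := by
    rw [abs_mul, abs_of_nonneg (sub_nonneg.2 hcd), abs_of_nonneg (cdf_nonneg m t)]
    nlinarith [cdf_le_one m t]
  calc |c + (d - c) * cdf m t - t| ≤ |c + (d - c) * cdf m t| + |t| := abs_sub _ _
    _ ≤ |c| + |(d - c) * cdf m t| + |t| := by gcongr; exact abs_add_le _ _
    _ ≤ _ := by linarith

lemma le_smul_comap_of_map_le (hS : MeasurableSet S) {ν : Measure S} {M : ℝ≥0}
    (h : ν.map ((↑) : S → ℝ) ≤ M • (volume : Measure ℝ)) :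
    ν ≤ M • Measure.comap ((↑) : S → ℝ) volume := by
  have e := MeasurableEmbedding.subtype_coe hS
  refine Measure.le_iff.2 fun A hA => ?_
  have h1 := Measure.le_iff'.1 h ((↑) '' A)
  rw [e.map_apply, Set.preimage_image_eq _ Subtype.val_injective] at h1
  rwa [Measure.smul_apply, e.comap_apply]

/-- The image of a measure under a spreading map has a bounded density. -/
lemma map_le_smul_comap (hS : IsClosed S) {γ : ℕ} {μ : Measure S}
    [IsProbabilityMeasure μ] [NullSingletonClass (μ.map fun x : S => (x : ℝ) ^ γ)] {Φ : S → S}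
    (hΦ : Measurable Φ) {c d h : ℝ} (hcd : c < d) (h0 : 0 < h) (h1 : h ≤ 1) {K : Set S}
    {R : ℝ} (hμK : ∀ᵐ x ∂μ, x ∈ K)
    (hΦs : ∀ x ∈ K, (Φ x : ℝ) ^ γ = spread (μ.map fun x : S => (x : ℝ) ^ γ) c d h ((x : ℝ) ^ γ))
    (hR : ∀ x ∈ K, |(Φ x : ℝ)| ≤ R)
    (hinj : Function.Injective fun x : S => (x : ℝ) ^ γ) (hKm : IsCompact K) :
    ∃ M : ℝ≥0, 1 ≤ M ∧ μ.map Φ ≤ M • Measure.comap ((↑) : S → ℝ) volume := by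
  set τ : S → ℝ := fun x => (x : ℝ) ^ γ with hτ
  have hτc : Continuous τ := by fun_prop
  set m := μ.map τ with hm
  have hprob : IsProbabilityMeasure m := Measure.isProbabilityMeasure_map hτc.aemeasurable
  have hhd : 0 < h * (d - c) := mul_pos h0 (sub_pos.2 hcd)
  set N : ℝ := max R 0 with hN
  have hN0 : 0 ≤ N := le_max_right _ _
  -- In the variable `x ^ γ` the image has density at most `1 / (h * (d - c))`; the factor `γ * N ^
  -- (γ - 1)` is the Lipschitz constant of the power on `[-N, N]`.
  set L : ℝ := γ * N ^ (γ - 1) / (h * (d - c)) with hL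
  have hL0 : 0 ≤ L := by positivity
  refine ⟨max 1 L.toNNReal, le_max_left _ _, le_smul_comap_of_map_le hS.measurableSet ?_⟩
  rw [Measure.map_map measurable_subtype_coe hΦ]
  have hmeas : Measurable (((↑) : S → ℝ) ∘ Φ) := measurable_subtype_coe.comp hΦ
  have : IsProbabilityMeasure (μ.map (((↑) : S → ℝ) ∘ Φ)) :=
    Measure.isProbabilityMeasure_map hmeas.aemeasurable
  refine le_smul_volume_of_Ioc _ _ fun a b hab => ?_
  rw [Measure.map_apply hmeas measurableSet_Ioc]
  have hτK : ∀ x y, x ∈ K → y ∈ K → (Φ x : ℝ) ∈ Set.Ioc a b → (Φ y : ℝ) ∈ Set.Ioc a b →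
      τ x ≤ τ y → cdf m (τ y) - cdf m (τ x) ≤ L * (b - a) := by
    intro x y hx hy hxa hya hxy
    have h2 := cdf_sub_le_spread_sub m (c := c) (d := d) h1 hxy
    rw [← hΦs x hx, ← hΦs y hy] at h2
    have h3 := abs_pow_sub_pow_le (Φ y : ℝ) (Φ x : ℝ) γ
    have h4 : |(Φ y : ℝ) - Φ x| ≤ b - a := by
      rw [abs_le]; constructor <;> linarith [hxa.1, hxa.2, hya.1, hya.2]
    have h5 : max |(Φ y : ℝ)| |(Φ x : ℝ)| ≤ N :=
      (max_le (hR y hy) (hR x hx)).trans (le_max_left _ _)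
    have h6 : h * (d - c) * (cdf m (τ y) - cdf m (τ x)) ≤ (b - a) * γ * N ^ (γ - 1) := by
      refine h2.trans ((le_abs_self _).trans (h3.trans ?_))
      have : (0 : ℝ) ≤ max |(Φ y : ℝ)| |(Φ x : ℝ)| := (abs_nonneg _).trans (le_max_left _ _)
      gcongr
    rw [hL, div_mul_eq_mul_div, le_div_iff₀ hhd]
    linarith
  obtain ⟨T, hTm, hT⟩ : ∃ T : Set ℝ, MeasurableSet T ∧
      τ ⁻¹' T = K ∩ (((↑) : S → ℝ) ∘ Φ) ⁻¹' Set.Ioc a b := by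
    have hemb : MeasurableEmbedding τ := hτc.measurableEmbedding hinj
    exact ⟨_, hemb.measurableSet_image.2 (hKm.measurableSet.inter (hmeas measurableSet_Ioc)),
      Set.preimage_image_eq _ hinj⟩
  have hT2 : (μ (((↑) : S → ℝ) ∘ Φ ⁻¹' Set.Ioc a b)) = m (T ∩ Set.range τ) := by
    rw [hm, (hτc.measurableEmbedding hinj).map_apply, Set.preimage_inter, Set.preimage_range,
      Set.inter_univ, hT]
    refine measure_congr ?_
    filter_upwards [hμK] with x hx
    exact propext ⟨fun h => ⟨hx, h⟩, fun h => h.2⟩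
  rw [hT2]
  have hrange : MeasurableSet (Set.range τ) := (hτc.measurableEmbedding hinj).measurableSet_range
  refine (measure_le_of_cdf_sub_le m (hTm.inter hrange) (D := L * (b - a)) ?_).trans
    (ENNReal.ofReal_le_ofReal ?_)
  · rintro _ ⟨hs, x, rfl⟩ _ ⟨ht, y, rfl⟩ hst
    have hx : x ∈ τ ⁻¹' T := hs
    have hy : y ∈ τ ⁻¹' T := ht
    rw [hT] at hx hy
    exact hτK x y hx.1 hy.1 hx.2 hy.2 hst
  · have : L ≤ ((max 1 L.toNNReal : ℝ≥0) : ℝ) := by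
      rw [NNReal.coe_max, Real.coe_toNNReal _ hL0]
      exact le_max_right _ _
    have h2 : 0 ≤ b - a := sub_nonneg.2 hab
    gcongr

/-- A compactly supported measure of finite logarithmic energy can be replaced by one with a
bounded density, at an arbitrarily small cost of energy. -/
lemma exists_bounded_density (hS : IsClosed S) (hSi : S.OrdConnected) [Nontrivial S]
    {β κ : ℝ} (hβ : 0 < β) (hκ : 0 < κ) {γ : ℕ}
    (hγ : 1 ≤ γ) (hS0 : Even γ → S ⊆ Set.Ici 0) {w : S → ℝ} (hw : Continuous w)
    (hwz : {x | w x = 0}.Finite) {μ : Measure S} [IsProbabilityMeasure μ] [NullSingletonClass μ]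
    {K : Set S} (hK : IsCompact K) (hKz : Disjoint K {x | w x = 0}) (hμK : μ Kᶜ = 0)
    (hint : Integrable (fun z : S × S => Real.log |(z.1 : ℝ) ^ γ - (z.2 : ℝ) ^ γ|) (μ.prod μ))
    {e : ℝ} (he : realEnergy β κ γ w μ < e) :
    ∃ (ν : Measure S) (_ : IsProbabilityMeasure ν) (M : ℝ≥0) (K' : Set S), 1 ≤ M ∧
      ν ≤ M • Measure.comap ((↑) : S → ℝ) volume ∧ IsCompact K' ∧
      Disjoint K' {x | w x = 0} ∧ ν K'ᶜ = 0 ∧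
      Integrable (fun z : S × S => Real.log |(z.1 : ℝ) ^ γ - (z.2 : ℝ) ^ γ|) (ν.prod ν) ∧
      realEnergy β κ γ w ν < e := by
  set τ : S → ℝ := fun x => (x : ℝ) ^ γ with hτ
  have hemb : IsClosedEmbedding τ := isClosedEmbedding_pow_coe hS hγ hS0
  have hmono : StrictMono τ := strictMono_pow_coe hγ hS0
  have hT : (Set.range τ).OrdConnected := ordConnected_range_pow_coe hSi γ
  have hme : MeasurableEmbedding τ := hemb.measurableEmbedding
  set m := μ.map τ with hm
  have hmprob : IsProbabilityMeasure m :=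
    Measure.isProbabilityMeasure_map hemb.continuous.measurable.aemeasurable
  have hmatom : NullSingletonClass m := by
    refine ⟨fun t => ?_⟩
    rw [hm, hme.map_apply]
    exact (Set.subsingleton_singleton.preimage hmono.injective).measure_zero μ
  obtain ⟨x₀, x₁, hx⟩ := exists_pair_lt S
  have hcd : τ x₀ < τ x₁ := hmono hx
  set c := τ x₀
  set d := τ x₁
  -- `r` is a measurable left inverse of `τ`, defined on the whole line. Since spreading preserves
  -- the range of `τ`, an interval, `Φ h` is the conjugate of the spreading map by `τ`.
  obtain ⟨r, hrm, hr⟩ := hme.exists_measurable_extend (g := id) measurable_id fun _ => ⟨x₀⟩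
  have hr' : ∀ x, r (τ x) = x := fun x => congrFun hr x
  set Φ : ℝ → S → S := fun h x => r (spread m c d h (τ x)) with hΦ
  have hΦm : ∀ h, Measurable (Φ h) := fun h =>
    hrm.comp ((measurable_spread m c d h).comp hemb.continuous.measurable)
  have hΦτ : ∀ h, 0 ≤ h → h ≤ 1 → ∀ x, τ (Φ h x) = spread m c d h (τ x) := by
    intro h h0 h1 x
    obtain ⟨y, hy⟩ := spread_mem (m := m) hT ⟨x₀, rfl⟩ ⟨x₁, rfl⟩ ⟨x, rfl⟩ hcd.le h0 h1
    rw [hΦ]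
    simp only
    rw [← hy, hr']
  -- a compact neighbourhood of `K` away from the zeros
  obtain ⟨δ, hδ, hdisj⟩ := ((Set.disjoint_image_iff hmono.injective).2 hKz).exists_cthickenings
    (hK.image hemb.continuous) (hwz.image τ).isClosed
  set K' : Set S := τ ⁻¹' Metric.cthickening δ (τ '' K) with hK'
  have hK'c : IsCompact K' := hemb.isCompact_preimage (hK.image hemb.continuous).cthickening
  have hK'z : Disjoint K' {x | w x = 0} := by
    rw [Set.disjoint_left]
    intro x hx hx0
    exact Set.disjoint_left.1 hdisj hx (Metric.self_subset_cthickening _ ⟨x, hx0, rfl⟩)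
  obtain ⟨T, hTK⟩ : ∃ T, ∀ x ∈ K, |τ x| ≤ T := by
    obtain ⟨T, hT⟩ := (hK.image hemb.continuous).isBounded.exists_norm_le
    exact ⟨T, fun x hx => hT _ ⟨x, hx, rfl⟩⟩
  set A := |c| + (d - c) + T with hA
  have hΦd : ∀ h, 0 ≤ h → h ≤ 1 → ∀ x ∈ K, |τ (Φ h x) - τ x| ≤ h * A := by
    intro h h0 h1 x hx
    rw [hΦτ h h0 h1]
    exact abs_spread_sub_self_le m hcd.le h0 (hTK x hx)
  have hnear : ∀ᶠ h : ℝ in 𝓝[>] 0, 0 < h ∧ h < 1 ∧ h * A < δ := by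
    have h1 : ∀ᶠ h : ℝ in 𝓝 0, h * A < δ :=
      (continuous_id.mul continuous_const).tendsto' 0 0 (by simp) |>.eventually (gt_mem_nhds hδ)
    filter_upwards [self_mem_nhdsWithin, nhdsWithin_le_nhds h1,
      nhdsWithin_le_nhds (gt_mem_nhds (zero_lt_one' ℝ))] with h a1 a2 a3
    exact ⟨a1, a3, a2⟩
  have hΦK' : ∀ᶠ h : ℝ in 𝓝[>] 0, ∀ x ∈ K, Φ h x ∈ K' := by
    filter_upwards [hnear] with h ⟨h0, h1, h2⟩ x hx
    refine Metric.mem_cthickening_of_dist_le _ (τ x) _ _ ⟨x, hx, rfl⟩ ?_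
    rw [Real.dist_eq]
    exact (hΦd h h0.le h1.le x hx).trans h2.le
  have hΦlim : ∀ x ∈ K, Tendsto (fun h => Φ h x) (𝓝[>] 0) (𝓝 x) := by
    intro x hx
    rw [hemb.isInducing.tendsto_nhds_iff, tendsto_iff_dist_tendsto_zero]
    have h0 : Tendsto (fun h : ℝ => h * A) (𝓝[>] 0) (𝓝 0) :=
      ((continuous_id.mul continuous_const).tendsto' 0 0 (by simp)).mono_left nhdsWithin_le_nhds
    refine squeeze_zero' (Eventually.of_forall fun _ => dist_nonneg) ?_ h0
    filter_upwards [hnear] with h ⟨h0, h1, _⟩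
    rw [Real.dist_eq]
    exact hΦd h h0.le h1.le x hx
  have hlogw : ContinuousOn (fun x => Real.log (w x)) K' :=
    hw.continuousOn.log fun x hx h => Set.disjoint_left.1 hK'z hx h
  obtain ⟨b, hb⟩ := hK'c.exists_bound_of_continuousOn hlogw
  have hae : ∀ᵐ x ∂μ, x ∈ K := (measure_eq_zero_iff_ae_notMem.1 hμK).mono fun x hx => not_not.1 hx
  have hwlim : Tendsto (fun h => ∫ x, Real.log (w (Φ h x)) ∂μ) (𝓝[>] 0)
      (𝓝 (∫ x, Real.log (w x) ∂μ)) := by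
    refine tendsto_integral_filter_of_dominated_convergence (fun _ => b)
      (Eventually.of_forall fun h => (hw.measurable.comp (hΦm h)).log.aestronglyMeasurable) ?_
      (integrable_const _) ?_
    · filter_upwards [hΦK'] with h hh
      filter_upwards [hae] with x hx
      exact hb _ (hh x hx)
    · filter_upwards [hae] with x hx
      have hx0 : w x ≠ 0 := fun h => Set.disjoint_left.1 hKz hx h
      exact ((hw.tendsto x).comp (hΦlim x hx)).log hx0
  set I := ∫ z : S × S, Real.log |(z.1 : ℝ) ^ γ - (z.2 : ℝ) ^ γ| ∂(μ.prod μ) with hI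
  -- The expression bounds the energy of the image of `μ` under `Φ h` from above, and it tends to
  -- the energy of `μ` as `h` decreases to `0`.
  have hElim : Tendsto (fun h => -(β / 2 * κ ^ 2 * (Real.log (1 - h) + I))
      - κ * ∫ x, Real.log (w (Φ h x)) ∂μ) (𝓝[>] 0) (𝓝 (realEnergy β κ γ w μ)) := by
    have h1 : Tendsto (fun h : ℝ => Real.log (1 - h)) (𝓝[>] 0) (𝓝 0) := by
      have : ContinuousAt (fun h : ℝ => Real.log (1 - h)) 0 :=
        ContinuousAt.log (by fun_prop) (by norm_num)
      have h2 := this.tendsto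
      simp only [sub_zero, Real.log_one] at h2
      exact h2.mono_left nhdsWithin_le_nhds
    have := (((h1.add_const I).const_mul (β / 2 * κ ^ 2)).neg).sub (hwlim.const_mul κ)
    rw [zero_add] at this
    exact this
  obtain ⟨h, hE, ⟨h0, h1, -⟩, hhK'⟩ :=
    ((hElim.eventually (gt_mem_nhds he)).and (hnear.and hΦK')).exists
  have hνK' : μ.map (Φ h) K'ᶜ = 0 := by
    rw [Measure.map_apply (hΦm h) hK'c.measurableSet.compl, measure_eq_zero_iff_ae_notMem]
    filter_upwards [hae] with x hx hx2
    exact hx2 (hhK' x hx)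
  obtain ⟨R, hR⟩ : ∃ R, ∀ x ∈ K', |(x : ℝ)| ≤ R := by
    obtain ⟨R, hR⟩ := (hK'c.image continuous_subtype_val).isBounded.exists_norm_le
    exact ⟨R, fun x hx => hR _ ⟨x, hx, rfl⟩⟩
  obtain ⟨M, hM1, hM⟩ := map_le_smul_comap hS (γ := γ) (hΦm h) hcd h0 h1.le (K := K) (R := R)
    hae (fun x _ => hΦτ h h0.le h1.le x) (fun x hx => hR _ (hhK' x hx)) hmono.injective hK
  have hprod : (μ.map (Φ h)).prod (μ.map (Φ h)) = (μ.prod μ).map (Prod.map (Φ h) (Φ h)) :=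
    Measure.map_prod_map _ _ (hΦm h) (hΦm h)
  have hmeas : Measurable fun z : S × S => Real.log |(z.1 : ℝ) ^ γ - (z.2 : ℝ) ^ γ| := by
    have : Measurable fun z : S × S => |(z.1 : ℝ) ^ γ - (z.2 : ℝ) ^ γ| := by fun_prop
    exact this.log
  have hlow : ∀ᵐ z : S × S ∂(μ.prod μ), Real.log (1 - h)
      + Real.log |(z.1 : ℝ) ^ γ - (z.2 : ℝ) ^ γ|
        ≤ Real.log |(Φ h z.1 : ℝ) ^ γ - (Φ h z.2 : ℝ) ^ γ| := by
    filter_upwards [measure_eq_zero_iff_ae_notMem.1 (measure_prod_diag μ)] with z hz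
    have hne : 0 < |(z.1 : ℝ) ^ γ - (z.2 : ℝ) ^ γ| :=
      abs_pos.2 (sub_ne_zero.2 fun h => hz (hmono.injective h))
    have h1h : 0 < 1 - h := sub_pos.2 h1
    rw [← Real.log_mul h1h.ne' hne.ne']
    refine Real.log_le_log (mul_pos h1h hne) ?_
    have e1 := hΦτ h h0.le h1.le z.1
    have e2 := hΦτ h h0.le h1.le z.2
    simp only [hτ] at e1 e2
    rw [e1, e2]
    exact abs_spread_sub_ge m hcd.le h0.le _ _
  have haez : ∀ᵐ z : S × S ∂(μ.prod μ), z.1 ∈ K ∧ z.2 ∈ K := by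
    filter_upwards [Measure.quasiMeasurePreserving_fst.ae hae,
      Measure.quasiMeasurePreserving_snd.ae hae] with z a1 a2 using ⟨a1, a2⟩
  have hup : ∀ᵐ z : S × S ∂(μ.prod μ),
      Real.log |(Φ h z.1 : ℝ) ^ γ - (Φ h z.2 : ℝ) ^ γ| ≤ R ^ γ + R ^ γ := by
    filter_upwards [haez] with z hz
    refine (Real.log_le_self (abs_nonneg _)).trans ((abs_sub _ _).trans ?_)
    rw [abs_pow, abs_pow]
    gcongr
    · exact hR _ (hhK' _ hz.1)
    · exact hR _ (hhK' _ hz.2)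
  -- The spread logarithm lies between an integrable function and a constant: from below by the
  -- contraction bound, from above by compactness.
  have hint' : Integrable (fun z : S × S =>
      Real.log |(Φ h z.1 : ℝ) ^ γ - (Φ h z.2 : ℝ) ^ γ|) (μ.prod μ) := by
    refine integrable_of_le_of_le ?_ hlow hup ((integrable_const _).add hint) (integrable_const _)
    exact (hmeas.comp ((hΦm h).prodMap (hΦm h))).aestronglyMeasurable
  have hνint : Integrable (fun z : S × S => Real.log |(z.1 : ℝ) ^ γ - (z.2 : ℝ) ^ γ|)
      ((μ.map (Φ h)).prod (μ.map (Φ h))) := by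
    rw [hprod, integrable_map_measure hmeas.aestronglyMeasurable
      ((hΦm h).prodMap (hΦm h)).aemeasurable]
    exact hint'
  refine ⟨μ.map (Φ h), Measure.isProbabilityMeasure_map (hΦm h).aemeasurable, M, K', hM1, hM, hK'c,
    hK'z, hνK', hνint, lt_of_le_of_lt ?_ hE⟩
  have hIν : ∫ z : S × S, Real.log |(z.1 : ℝ) ^ γ - (z.2 : ℝ) ^ γ|
      ∂((μ.map (Φ h)).prod (μ.map (Φ h)))
        = ∫ z : S × S, Real.log |(Φ h z.1 : ℝ) ^ γ - (Φ h z.2 : ℝ) ^ γ| ∂(μ.prod μ) := by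
    rw [hprod, integral_map ((hΦm h).prodMap (hΦm h)).aemeasurable hmeas.aestronglyMeasurable]
    rfl
  have hIge : Real.log (1 - h) + I
      ≤ ∫ z : S × S, Real.log |(Φ h z.1 : ℝ) ^ γ - (Φ h z.2 : ℝ) ^ γ| ∂(μ.prod μ) := by
    have h2 : ∫ z : S × S, (Real.log (1 - h) + Real.log |(z.1 : ℝ) ^ γ - (z.2 : ℝ) ^ γ|) ∂(μ.prod μ)
        ≤ ∫ z : S × S, Real.log |(Φ h z.1 : ℝ) ^ γ - (Φ h z.2 : ℝ) ^ γ| ∂(μ.prod μ) :=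
      integral_mono_ae ((integrable_const _).add hint) hint' hlow
    have h3 : ∫ z : S × S, (Real.log (1 - h) + Real.log |(z.1 : ℝ) ^ γ - (z.2 : ℝ) ^ γ|) ∂(μ.prod μ)
        = Real.log (1 - h) + I := by
      rw [integral_add (integrable_const _) hint]
      simp [hI]
    rwa [h3] at h2
  unfold realEnergy
  rw [hIν, integral_map (hΦm h).aemeasurable hw.measurable.log.aestronglyMeasurable]
  gcongr

/-! ### Restriction to a compact set away from the zeros -/

/-- A measure of finite energy can be replaced by one with compact support away from the zeros of
the weight, at an arbitrarily small cost of energy. -/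
lemma exists_compact_support (hS : IsClosed S)
    {β κ : ℝ} (hβ : 0 < β) (hκ : 0 < κ) {γ : ℕ}
    {ε C : ℝ} (hε : 0 < ε) (hC : 1 ≤ C) {w : S → ℝ}
    (hwc : Continuous w) (hw : ∀ x, 0 ≤ w x)
    (hwz : {x | w x = 0}.Finite) (hq : ∀ x, scaled (γ * κ * β + ε) C w x ≤ 1)
    {μ : Measure S} [IsProbabilityMeasure μ] {E : ℝ}
    (hE : ∫⁻ z, excess β κ γ ε C w z ∂(μ.prod μ) < ENNReal.ofReal (E + κ * Real.log C)) :
    ∃ (ν : Measure S) (_ : IsProbabilityMeasure ν) (K : Set S),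
      NullSingletonClass ν ∧ IsCompact K ∧ Disjoint K {x | w x = 0} ∧ ν Kᶜ = 0 ∧
      Integrable (fun z : S × S => Real.log |(z.1 : ℝ) ^ γ - (z.2 : ℝ) ^ γ|) (ν.prod ν) ∧
      realEnergy β κ γ w ν < E := by
  have hC0 : 0 < C := one_pos.trans_le hC
  set H := excess β κ γ ε C w with hH
  have hHm : Measurable H := measurable_excess β κ γ ε C hwc
  have hfin : ∫⁻ z, H z ∂(μ.prod μ) ≠ ⊤ := hE.ne_top
  -- Finite energy forces the set where the kernel is infinite to be null; by Fubini, `μ` then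
  -- charges neither the zeros of `w` nor any single point.
  have hreg : ∀ᵐ z ∂(μ.prod μ),
      ¬((z.1 : ℝ) ^ γ = (z.2 : ℝ) ^ γ ∨ w z.1 = 0 ∨ w z.2 = 0) := by
    filter_upwards [ae_lt_top hHm hfin] with z hz hsing
    simp only [hH, excess, if_pos hsing, lt_self_iff_false] at hz
  have hwpos : ∀ᵐ x ∂μ, w x ≠ 0 := by
    have h1 : ∀ᵐ x : S ∂μ, ∀ᵐ y : S ∂μ, ¬((x : ℝ) ^ γ = (y : ℝ) ^ γ ∨ w x = 0 ∨ w y = 0) :=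
      Measure.ae_ae_of_ae_prod hreg
    filter_upwards [h1] with x hx h0
    obtain ⟨y, hy⟩ := hx.exists
    exact hy (Or.inr (Or.inl h0))
  have hatom : NullSingletonClass μ := by
    refine nullSingletonClass_of_prod_diag μ (measure_eq_zero_iff_ae_notMem.2 ?_)
    filter_upwards [hreg] with z hz h
    have h : z.1 = z.2 := h
    exact hz (Or.inl (by rw [h]))
  -- exhaustion by compact sets
  set U : Set S := {x | w x = 0}ᶜ with hU
  have hUo : IsOpen U := hwz.isClosed.isOpen_compl
  have hμU : μ U = 1 := by
    rw [prob_compl_eq_one_iff hwz.measurableSet, measure_eq_zero_iff_ae_notMem]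
    exact hwpos
  -- Since the excess is nonnegative, conditioning on `K` multiplies its integral by at most `(μ
  -- K)⁻²`. As `μ K` approaches `1` this factor does not spoil the strict inequality.
  have hlim : Tendsto (fun t : ℝ≥0∞ => t⁻¹ * t⁻¹ * ∫⁻ z, H z ∂(μ.prod μ)) (𝓝 1)
      (𝓝 (∫⁻ z, H z ∂(μ.prod μ))) := by
    have h1 : Tendsto (fun t : ℝ≥0∞ => t⁻¹) (𝓝 1) (𝓝 1) :=
      continuous_inv.tendsto' 1 1 inv_one
    have h2 := ENNReal.Tendsto.mul_const (b := ∫⁻ z, H z ∂(μ.prod μ))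
      (ENNReal.Tendsto.mul h1 (Or.inl one_ne_zero) h1 (Or.inl one_ne_zero)) (Or.inr hfin)
    simpa using h2
  obtain ⟨t, ht1, ht⟩ : ∃ t < (1 : ℝ≥0∞), ∀ s, t < s → s ≤ 1 →
      s⁻¹ * s⁻¹ * ∫⁻ z, H z ∂(μ.prod μ) < ENNReal.ofReal (E + κ * Real.log C) := by
    obtain ⟨t, ht1, ht⟩ := exists_Ioc_subset_of_mem_nhds
      (hlim.eventually (gt_mem_nhds hE)) ⟨0, zero_lt_one⟩
    exact ⟨t, ht1, fun s h1 h2 => ht ⟨h1, h2⟩⟩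
  obtain ⟨K, hKU, hK, hKt⟩ := hUo.exists_lt_isCompact (hμU ▸ ht1 : t < μ U)
  have hKz : Disjoint K {x | w x = 0} := Set.disjoint_compl_right_iff_subset.2 hKU |>.mono_right
    (by rw [hU, compl_compl])
  have hK0 : μ K ≠ 0 := (bot_le.trans_lt hKt).ne'
  have hν : IsProbabilityMeasure (μ[|K]) := cond_isProbabilityMeasure hK0
  have hνprod : (μ[|K]).prod (μ[|K]) = ((μ K)⁻¹ * (μ K)⁻¹) • (μ.prod μ).restrict (K ×ˢ K) := by
    unfold ProbabilityTheory.cond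
    rw [Measure.prod_smul_left, Measure.prod_smul_right, smul_smul, Measure.prod_restrict]
  have hνE : ∫⁻ z, H z ∂((μ[|K]).prod (μ[|K])) < ENNReal.ofReal (E + κ * Real.log C) := by
    refine lt_of_le_of_lt ?_ (ht (μ K) hKt prob_le_one)
    rw [hνprod, lintegral_smul_measure, smul_eq_mul]
    gcongr
    exact Measure.restrict_le_self
  have hac : (μ[|K]).prod (μ[|K]) ≪ μ.prod μ := by
    rw [hνprod]
    exact Measure.restrict_le_self.absolutelyContinuous.smul_left _
  have hνreg := hac.ae_le hreg
  have hνK : (μ[|K]) Kᶜ = 0 := by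
    rw [cond_apply hK.measurableSet, Set.inter_compl_self, measure_empty, mul_zero]
  refine ⟨μ[|K], hν, K, ⟨fun x => cond_absolutelyContinuous (measure_singleton x)⟩, hK, hKz, hνK,
    ?_⟩
  have hnn : ∀ z, 0 ≤ excessReal β κ γ ε C w z := excessReal_nonneg hβ hκ γ hε hC0 hw hq
  have hHr : ∫⁻ z, ENNReal.ofReal (excessReal β κ γ ε C w z) ∂((μ[|K]).prod (μ[|K]))
      = ∫⁻ z, H z ∂((μ[|K]).prod (μ[|K])) := by
    refine lintegral_congr_ae ?_
    filter_upwards [hνreg] with z hz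
    rw [hH, excess, if_neg hz]
  have hri : Integrable (excessReal β κ γ ε C w) ((μ[|K]).prod (μ[|K])) := by
    refine (lintegral_ofReal_ne_top_iff_integrable
      (measurable_excessReal β κ γ ε C hwc).aestronglyMeasurable
      (Eventually.of_forall hnn)).1 ?_
    rw [hHr]
    exact hνE.ne_top
  have hlogw : Integrable (fun x => Real.log (w x)) (μ[|K]) :=
    integrable_of_continuousOn_compact hK hνK
      (hwc.continuousOn.log fun x hx h => Set.disjoint_left.1 hKz hx h)
  have hb : 0 < β / 2 * κ ^ 2 := by positivity
  have hlog1 := hlogw.comp_fst (μ[|K])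
  have hlog2 := hlogw.comp_snd (μ[|K])
  have hae : ∀ᵐ z ∂((μ[|K]).prod (μ[|K])), excessReal β κ γ ε C w z
      = β / 2 * κ ^ 2 * -Real.log |(z.1 : ℝ) ^ γ - (z.2 : ℝ) ^ γ|
      - κ / 2 * (Real.log (w z.1) + Real.log (w z.2)) + κ * Real.log C := by
    filter_upwards [hνreg] with z hz using excessReal_eq hC0 hw hz
  have hint : Integrable (fun z : S × S => Real.log |(z.1 : ℝ) ^ γ - (z.2 : ℝ) ^ γ|)
      ((μ[|K]).prod (μ[|K])) := by
    have h1 := ((hri.sub (integrable_const (κ * Real.log C))).add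
      ((hlog1.add hlog2).const_mul (κ / 2))).const_mul (-(β / 2 * κ ^ 2)⁻¹)
    refine h1.congr ?_
    filter_upwards [hae] with z hz
    simp only [Pi.add_apply, Pi.sub_apply, hz]
    field_simp
    ring
  refine ⟨hint, ?_⟩
  have h1 : ∫ z, excessReal β κ γ ε C w z ∂((μ[|K]).prod (μ[|K]))
      = realEnergy β κ γ w (μ[|K]) + κ * Real.log C := by
    have i1 : Integrable (fun z : S × S => β / 2 * κ ^ 2 *
        -Real.log |(z.1 : ℝ) ^ γ - (z.2 : ℝ) ^ γ|) ((μ[|K]).prod (μ[|K])) := hint.neg.const_mul _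
    have i2 : Integrable (fun z : S × S => κ / 2 * (Real.log (w z.1) + Real.log (w z.2)))
        ((μ[|K]).prod (μ[|K])) := (hlog1.add hlog2).const_mul _
    have i3 : Integrable (fun z : S × S => β / 2 * κ ^ 2 *
        -Real.log |(z.1 : ℝ) ^ γ - (z.2 : ℝ) ^ γ|
        - κ / 2 * (Real.log (w z.1) + Real.log (w z.2))) ((μ[|K]).prod (μ[|K])) := i1.sub i2
    rw [integral_congr_ae hae, integral_add i3 (integrable_const _), integral_sub i1 i2,
      integral_const_mul, integral_const_mul, integral_neg, integral_add hlog1 hlog2,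
      integral_fun_fst (fun x => Real.log (w x)), integral_fun_snd (fun x => Real.log (w x))]
    simp only [probReal_univ, one_smul, integral_const]
    unfold realEnergy
    ring
  have h2 : ∫ z, excessReal β κ γ ε C w z ∂((μ[|K]).prod (μ[|K])) < E + κ * Real.log C := by
    rw [← hHr, ← ofReal_integral_eq_lintegral_ofReal hri (Eventually.of_forall hnn)] at hνE
    exact (ENNReal.ofReal_lt_ofReal_iff_of_nonneg (integral_nonneg hnn)).1 hνE
  linarith

/-! ### The lower bound at the level of the minimizer -/

lemma lintegral_pi_prod_eq_pow {X : Type*} [MeasurableSpace X] (μ : Measure X) [SigmaFinite μ]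
    {f : X → ℝ≥0∞} (hf : Measurable f) (m : ℕ) :
    ∫⁻ x : Fin m → X, ∏ i, f (x i) ∂(Measure.pi fun _ => μ) = (∫⁻ x, f x ∂μ) ^ m := by
  induction m with
  | zero => rw [Measure.pi_of_empty (fun _ : Fin 0 => μ)]; simp
  | succ m ih =>
    have e := (measurePreserving_piFinSuccAbove (fun _ : Fin (m + 1) => μ) 0).symm
    have hmeas : Measurable fun x : Fin m → X => ∏ i, f (x i) :=
      Finset.measurable_prod _ fun i _ => hf.comp (measurable_pi_apply i)
    have hmeas' : Measurable fun x : Fin (m + 1) → X => ∏ i, f (x i) :=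
      Finset.measurable_prod _ fun i _ => hf.comp (measurable_pi_apply i)
    rw [← e.lintegral_comp hmeas']
    have h : ∀ z : X × (Fin m → X),
        ∏ i, f ((MeasurableEquiv.piFinSuccAbove (fun _ : Fin (m + 1) => X) 0).symm z i)
          = f z.1 * ∏ i, f (z.2 i) := by
      intro z
      rw [Fin.prod_univ_succ]
      rfl
    rw [lintegral_congr h, lintegral_prod_mul hf.aemeasurable hmeas.aemeasurable, ih, pow_succ']

/-- The energy in terms of the normalized kernel. -/
lemma lintegral_excess_of_energy_eq {β κ : ℝ} (hβ : 0 < β) (hκ : 0 < κ) {γ : ℕ} {ε C : ℝ}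
    (hε : 0 < ε) (hC : 1 ≤ C) {w : S → ℝ} (hwc : Continuous w) (hw : ∀ x, 0 ≤ w x)
    (hq : ∀ x, scaled (γ * κ * β + ε) C w x ≤ 1) {μ : ProbabilityMeasure S} {E : ℝ}
    (hE : energy β κ γ w μ = E) :
    ∫⁻ z, excess β κ γ ε C w z ∂((μ : Measure S).prod (μ : Measure S))
        = ENNReal.ofReal (E + κ * Real.log C) ∧ 0 ≤ E + κ * Real.log C := by
  rw [energy_eq hβ hκ hε hC hwc hw hq] at hE
  generalize (∫⁻ z, excess β κ γ ε C w z ∂((μ : Measure S).prod (μ : Measure S))) = G at hE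
  induction G with
  | top =>
    rw [EReal.coe_ennreal_top, EReal.top_sub_coe] at hE
    exact absurd hE (EReal.coe_ne_top _).symm
  | coe r =>
    have e : ((r : ℝ≥0∞) : EReal) = ((r : ℝ) : EReal) := rfl
    rw [e, ← EReal.coe_sub, EReal.coe_eq_coe_iff] at hE
    have h2 : E + κ * Real.log C = r := by linarith
    rw [h2, ENNReal.ofReal_coe_nnreal]
    exact ⟨rfl, r.2⟩

lemma energy_le_of_lintegral_excess_le {β κ : ℝ} (hβ : 0 < β) (hκ : 0 < κ) {γ : ℕ} {ε C : ℝ}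
    (hε : 0 < ε) (hC : 1 ≤ C) {w : S → ℝ} (hwc : Continuous w) (hw : ∀ x, 0 ≤ w x)
    (hq : ∀ x, scaled (γ * κ * β + ε) C w x ≤ 1) {μ : ProbabilityMeasure S} {E : ℝ}
    (h0 : 0 ≤ E + κ * Real.log C)
    (hE : ∫⁻ z, excess β κ γ ε C w z ∂((μ : Measure S).prod (μ : Measure S))
        ≤ ENNReal.ofReal (E + κ * Real.log C)) :
    energy β κ γ w μ ≤ E := by
  rw [energy_eq hβ hκ hε hC hwc hw hq]
  generalize (∫⁻ z, excess β κ γ ε C w z ∂((μ : Measure S).prod (μ : Measure S))) = G at hE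
  lift G to ℝ≥0 using ne_top_of_le_ne_top ENNReal.ofReal_ne_top hE
  have e : ((G : ℝ≥0∞) : EReal) = ((G : ℝ) : EReal) := rfl
  rw [e, ← EReal.coe_sub, EReal.coe_le_coe_iff]
  rw [← ENNReal.ofReal_coe_nnreal, ENNReal.ofReal_le_ofReal_iff h0] at hE
  linarith

/-- The lower bound on the partition function. -/
lemma eventually_exp_le_partitionFunction (hS : IsClosed S) (hSi : S.OrdConnected) [Nontrivial S]
    {β κ : ℝ} (hβ : 0 < β) (hκ : 0 < κ) {γ : ℕ} (hγ : 1 ≤ γ)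
    (hS0 : Even γ → S ⊆ Set.Ici 0) {p : ℕ → ℕ}
    (hp : Tendsto (fun n : ℕ => (p n : ℝ) / n) atTop (𝓝 κ))
    {wn : ℕ → S → ℝ} (hwn : ∀ n, Continuous (wn n))
    (hnn : ∀ n x, 0 ≤ wn n x) {w : S → ℝ} (ha1 : WeightLimit wn w) {ε C : ℝ} (hε : 0 < ε)
    (hsc : ScaledWeights wn w (γ * κ * β + ε) C)
    {μ : ProbabilityMeasure S} {E : ℝ} (hE : energy β κ γ w μ = E) {e : ℝ} (he : E < e) :
    ∀ᶠ n : ℕ in atTop, ENNReal.ofReal (Real.exp (-((n : ℝ) ^ 2 * e)))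
      ≤ partitionFunction β γ n (wn n) (p n) := by
  obtain ⟨h1, h2⟩ := lintegral_excess_of_energy_eq hβ hκ hε hsc.one_le ha1.continuous ha1.nonneg
    hsc.limit_le_one hE
  have h3 : ∫⁻ z, excess β κ γ ε C w z ∂((μ : Measure S).prod (μ : Measure S))
      < ENNReal.ofReal (e + κ * Real.log C) := by
    rw [h1]
    exact (ENNReal.ofReal_lt_ofReal_iff_of_nonneg h2).2 (by linarith)
  obtain ⟨ν, hν, K, hatom, hK, hKz, hνK, hint, hνE⟩ := exists_compact_support hS hβ hκ hε
    hsc.one_le ha1.continuous ha1.nonneg ha1.finite_zeros hsc.limit_le_one h3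
  obtain ⟨ν', hν', M, K', hM1, hM, hK', hK'z, hν'K, hint', hν'E⟩ := exists_bounded_density hS hSi
    hβ hκ hγ hS0 ha1.continuous ha1.finite_zeros hK hKz hνK hint hνE
  exact eventually_exp_realEnergy_le hS hγ hS0 hp hwn hnn ha1 hM1 hM hK' hK'z hν'K hint' hν'E

/-! ### Configurations of small weight are improbable -/

lemma log_weight_le {β : ℝ} (hβ : 0 < β) {γ n : ℕ} (hn : n ≠ 0) {v : S → ℝ} (hv : ∀ x, 0 ≤ v x)
    {a C : ℝ} (hC : 0 < C) (hq : ∀ x, scaled a C v x ≤ 1) {m : ℕ} {x : Fin m → S}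
    (h : 0 < weight β γ n v x) :
    Real.log (weight β γ n v x)
      ≤ n * m * Real.log C - (n * a - β * γ * (m - 1)) * ∑ j, growth (x j) := by
  have h1 := neg_log_weight_eq (β := β) (n := n) (a := a) hC (ne_of_weight_pos hβ h) (pos_of_weight_pos hn hv h)
  have h2 : 0 ≤ β * ∑ i, ∑ j ∈ Finset.Ioi i, -Real.log (normDist γ (x i) (x j)) :=
    mul_nonneg hβ.le (Finset.sum_nonneg fun i _ => Finset.sum_nonneg fun j _ =>
      neg_log_nonneg (normDist_nonneg _ _ _) (normDist_le_one _ _ _))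
  have h3 : 0 ≤ n * ∑ j, -Real.log (scaled a C v (x j)) :=
    mul_nonneg (Nat.cast_nonneg _) (Finset.sum_nonneg fun j _ =>
      neg_log_nonneg (scaled_nonneg hC (hv _)) (hq _))
  linarith

lemma lintegral_one_add_abs_lt_top (hS : MeasurableSet S) :
    ∫⁻ x : S, ENNReal.ofReal (Real.exp (-2 * growth x))
      ∂(Measure.comap ((↑) : S → ℝ) volume) < ∞ := by
  have h1 : ∀ x : S, ENNReal.ofReal (Real.exp (-2 * growth x))
      = (fun t : ℝ => ENNReal.ofReal ((1 + ‖t‖) ^ (-(2 : ℝ)))) x := by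
    intro x
    have hx := one_add_abs_pos x
    simp only [growth, Real.norm_eq_abs]
    rw [Real.rpow_def_of_pos hx, mul_comm]
  rw [lintegral_congr h1, lintegral_subtype_comap hS
    (fun t : ℝ => ENNReal.ofReal ((1 + ‖t‖) ^ (-(2 : ℝ))))]
  refine (setLIntegral_le_lintegral _ _).trans_lt (finite_integral_one_add_norm ?_)
  norm_num

/-- The weight is integrably small where it is below a given level. -/
lemma setLIntegral_weight_le (hS : IsClosed S) {β : ℝ} (hβ : 0 < β) {γ n : ℕ} (hn : n ≠ 0)
    {v : S → ℝ} (hvc : Continuous v) (hv : ∀ x, 0 ≤ v x) {a C ε : ℝ} (hC : 1 ≤ C) (hε : 0 < ε)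
    (hq : ∀ x, scaled a C v x ≤ 1) {m : ℕ}
    (hgrow : n * (ε / 2) ≤ n * a - β * γ * (m - 1)) (hnε : 4 / ε ≤ n) (s : ℝ) :
    ∫⁻ x in {x | weight β γ n v x < Real.exp s}, ENNReal.ofReal (weight β γ n v x) ∂(lebesgue S m)
      ≤ ENNReal.ofReal (Real.exp ((1 - 4 / (ε * n)) * s + m * (4 / ε * Real.log C)))
        * (∫⁻ x : S, ENNReal.ofReal (Real.exp (-2 * growth x))
          ∂(Measure.comap ((↑) : S → ℝ) volume)) ^ m := by
  have := sigmaFinite_comap_coe hS.measurableSet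
  have hn0 : (0 : ℝ) < n := by exact_mod_cast Nat.pos_of_ne_zero hn
  -- The weight is split as `weight ^ (1 - η) * weight ^ η`. The first factor is bounded by the
  -- threshold. Since `η * n * (ε / 2) = 2`, the second is at most a constant times `∏ (1 +
  -- |x_j|)⁻²`, which is integrable.
  set η : ℝ := 4 / (ε * n) with hη
  have hη0 : 0 < η := by positivity
  have hη1 : η ≤ 1 := by
    rw [hη, div_le_one (by positivity)]
    rwa [div_le_iff₀ hε, mul_comm] at hnε
  have hηn : η * n = 4 / ε := by rw [hη]; field_simp
  have hpt : ∀ x : Fin m → S, weight β γ n v x < Real.exp s →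
      ENNReal.ofReal (weight β γ n v x)
        ≤ ENNReal.ofReal (Real.exp ((1 - η) * s + m * (4 / ε * Real.log C)))
          * ∏ j, ENNReal.ofReal (Real.exp (-2 * growth (x j))) := by
    intro x hx
    rcases (weight_nonneg β γ n hv x).eq_or_lt with h0 | h0
    · rw [← h0, ENNReal.ofReal_zero]; exact zero_le
    rw [← ENNReal.ofReal_prod_of_nonneg fun j _ => (Real.exp_pos _).le,
      ← ENNReal.ofReal_mul (Real.exp_pos _).le, ← Real.exp_sum, ← Real.exp_add]
    refine ENNReal.ofReal_le_ofReal ?_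
    rw [← Real.log_le_iff_le_exp h0]
    have h1 : Real.log (weight β γ n v x) ≤ s := (Real.log_le_iff_le_exp h0).2 hx.le
    have h2 := log_weight_le hβ hn hv (zero_lt_one.trans_le hC) hq h0
    have h3 : 0 ≤ ∑ j, growth (x j) := Finset.sum_nonneg fun j _ => growth_nonneg _
    have h4 : Real.log (weight β γ n v x)
        ≤ n * m * Real.log C - n * (ε / 2) * ∑ j, growth (x j) := by
      have := mul_le_mul_of_nonneg_right hgrow h3
      linarith
    have h5 : η * Real.log (weight β γ n v x)
        ≤ m * (4 / ε * Real.log C) - 2 * ∑ j, growth (x j) := by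
      calc η * Real.log (weight β γ n v x)
          ≤ η * (n * m * Real.log C - n * (ε / 2) * ∑ j, growth (x j)) := by gcongr
        _ = (η * n) * (m * Real.log C) - (η * n) * (ε / 2) * ∑ j, growth (x j) := by ring
        _ = _ := by rw [hηn]; field_simp; ring
    have h6 := mul_le_mul_of_nonneg_left h1 (sub_nonneg.2 hη1)
    rw [← Finset.mul_sum]
    linarith
  have hmeas : MeasurableSet {x : Fin m → S | weight β γ n v x < Real.exp s} :=
    measurableSet_lt (measurable_weight β γ n hvc) measurable_const
  have hgm : Measurable fun x : S => ENNReal.ofReal (Real.exp (-2 * growth x)) :=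
    (Real.measurable_exp.comp (continuous_growth.measurable.const_mul _)).ennreal_ofReal
  calc _ ≤ ∫⁻ x in {x | weight β γ n v x < Real.exp s},
        ENNReal.ofReal (Real.exp ((1 - η) * s + m * (4 / ε * Real.log C)))
          * ∏ j, ENNReal.ofReal (Real.exp (-2 * growth (x j))) ∂(lebesgue S m) :=
        setLIntegral_mono' hmeas hpt
    _ ≤ ∫⁻ x, ENNReal.ofReal (Real.exp ((1 - η) * s + m * (4 / ε * Real.log C)))
          * ∏ j, ENNReal.ofReal (Real.exp (-2 * growth (x j))) ∂(lebesgue S m) :=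
        setLIntegral_le_lintegral _ _
    _ = _ := by
        rw [lintegral_const_mul' _ _ ENNReal.ofReal_ne_top, lebesgue,
          lintegral_pi_prod_eq_pow _ hgm]

/-- The law gives exponentially small mass to configurations of small weight. -/
lemma eventually_ensembleLaw_le (hS : IsClosed S) {β κ : ℝ} (hβ : 0 < β) {γ : ℕ}
    {p : ℕ → ℕ} (hp : Tendsto (fun n : ℕ => (p n : ℝ) / n) atTop (𝓝 κ))
    {wn : ℕ → S → ℝ} (hwn : ∀ n, Continuous (wn n)) (hnn : ∀ n x, 0 ≤ wn n x) {w : S → ℝ}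
    {ε C : ℝ} (hε : 0 < ε) (hsc : ScaledWeights wn w (γ * κ * β + ε) C) {E : ℝ}
    (hZ : ∀ e > E, ∀ᶠ n : ℕ in atTop, ENNReal.ofReal (Real.exp (-((n : ℝ) ^ 2 * e)))
      ≤ partitionFunction β γ n (wn n) (p n)) {δ : ℝ} (hδ : 0 < δ) :
    ∀ᶠ n : ℕ in atTop, ensembleLaw β γ n (wn n) (p n)
      {x | weight β γ n (wn n) x < Real.exp (-((n : ℝ) ^ 2 * (E + δ)))}
        ≤ ENNReal.ofReal (Real.exp (-n)) := by
  set D := ∫⁻ x : S, ENNReal.ofReal (Real.exp (-2 * growth x))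
    ∂(Measure.comap ((↑) : S → ℝ) volume) with hD
  have hDtop : D < ∞ := lintegral_one_add_abs_lt_top hS.measurableSet
  obtain ⟨d, hd⟩ : ∃ d : ℝ, D ≤ ENNReal.ofReal (Real.exp d) := by
    refine ⟨D.toReal, ?_⟩
    calc D = ENNReal.ofReal D.toReal := (ENNReal.ofReal_toReal hDtop.ne).symm
      _ ≤ _ := ENNReal.ofReal_le_ofReal (by linarith [Real.add_one_le_exp D.toReal])
  have hinv : Tendsto (fun n : ℕ => (1 : ℝ) / n) atTop (𝓝 0) := tendsto_one_div_atTop_nhds_zero_nat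
  have hgrow : ∀ᶠ n : ℕ in atTop,
      (n : ℝ) * (ε / 2) ≤ n * (γ * κ * β + ε) - β * γ * ((p n : ℝ) - 1) := by
    have h1 : Tendsto (fun n : ℕ => β * γ * ((p n : ℝ) / n - 1 / n)) atTop (𝓝 (β * γ * (κ - 0))) :=
      (hp.sub hinv).const_mul _
    have h2 : β * γ * (κ - 0) < γ * κ * β + ε / 2 := by
      rw [sub_zero]
      linarith
    filter_upwards [h1.eventually (gt_mem_nhds h2), eventually_ge_atTop 1] with n h3 h4
    have hn0 : (0 : ℝ) < n := by exact_mod_cast h4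
    have h5 := mul_le_mul_of_nonneg_left h3.le hn0.le
    have h6 : (n : ℝ) * (β * γ * ((p n : ℝ) / n - 1 / n)) = β * γ * ((p n : ℝ) - 1) := by
      field_simp
    rw [h6] at h5
    linarith
  -- At scale `n ^ 2` only the gap `(E + δ / 2) - (E + δ) = -δ / 2` survives; the correction from
  -- `η`, the constants `C` and `d`, and the target `-n` are all `O(n)`.
  have hexp : ∀ᶠ n : ℕ in atTop, (n : ℝ) ^ 2 * (E + δ / 2)
      + ((1 - 4 / (ε * n)) * -((n : ℝ) ^ 2 * (E + δ)) + p n * (4 / ε * Real.log C)) + p n * d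
        ≤ -n := by
    have h1 : Tendsto (fun n : ℕ => -(δ / 2) + 4 / ε * (E + δ) * (1 / n)
        + (p n : ℝ) / n * (1 / n) * (4 / ε * Real.log C) + (p n : ℝ) / n * (1 / n) * d + 1 / n)
        atTop (𝓝 (-(δ / 2) + 4 / ε * (E + δ) * 0 + κ * 0 * (4 / ε * Real.log C) + κ * 0 * d + 0)) :=
      ((((hinv.const_mul _).const_add _).add ((hp.mul hinv).mul_const _)).add
        ((hp.mul hinv).mul_const _)).add hinv
    have h2 : -(δ / 2) + 4 / ε * (E + δ) * 0 + κ * 0 * (4 / ε * Real.log C) + κ * 0 * d + 0 < 0 := by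
      simp only [mul_zero, zero_mul, add_zero]
      linarith
    filter_upwards [h1.eventually (gt_mem_nhds h2), eventually_ge_atTop 1] with n h3 h4
    have hn0 : (0 : ℝ) < n := by exact_mod_cast h4
    have h5 := mul_le_mul_of_nonneg_left h3.le (sq_nonneg (n : ℝ))
    have h6 : (n : ℝ) ^ 2 * (-(δ / 2) + 4 / ε * (E + δ) * (1 / n)
        + (p n : ℝ) / n * (1 / n) * (4 / ε * Real.log C) + (p n : ℝ) / n * (1 / n) * d + 1 / n)
        = (n : ℝ) ^ 2 * (E + δ / 2)
      + ((1 - 4 / (ε * n)) * -((n : ℝ) ^ 2 * (E + δ)) + p n * (4 / ε * Real.log C)) + p n * d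
        + n := by
      field_simp
      ring
    rw [h6, mul_zero] at h5
    linarith
  filter_upwards [hZ (E + δ / 2) (by linarith), hgrow, hexp, hsc.le_one, eventually_ge_atTop 1,
    eventually_ge_atTop ⌈4 / ε⌉₊] with n h1 h2 h3 h4 h5 h6
  have hmeas : MeasurableSet {x : Fin (p n) → S | weight β γ n (wn n) x
      < Real.exp (-((n : ℝ) ^ 2 * (E + δ)))} :=
    measurableSet_lt (measurable_weight β γ n (hwn n)) measurable_const
  have hZinv : (partitionFunction β γ n (wn n) (p n))⁻¹
      ≤ ENNReal.ofReal (Real.exp ((n : ℝ) ^ 2 * (E + δ / 2))) := by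
    rw [ENNReal.inv_le_iff_inv_le, ← ENNReal.ofReal_inv_of_pos (Real.exp_pos _), ← Real.exp_neg]
    exact h1
  rw [ensembleLaw, withDensity_apply _ hmeas,
    lintegral_const_mul _ (measurable_weight β γ n (hwn n)).ennreal_ofReal]
  calc _ ≤ ENNReal.ofReal (Real.exp ((n : ℝ) ^ 2 * (E + δ / 2))) *
        (ENNReal.ofReal (Real.exp ((1 - 4 / (ε * n)) * -((n : ℝ) ^ 2 * (E + δ))
          + p n * (4 / ε * Real.log C))) * ENNReal.ofReal (Real.exp d) ^ (p n)) := by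
        refine mul_le_mul' hZinv ((setLIntegral_weight_le hS hβ (by omega) (hwn n) (hnn n)
          hsc.one_le hε h4 h2 ((Nat.le_ceil _).trans (by exact_mod_cast h6)) _).trans ?_)
        gcongr
    _ = ENNReal.ofReal (Real.exp ((n : ℝ) ^ 2 * (E + δ / 2)
      + ((1 - 4 / (ε * n)) * -((n : ℝ) ^ 2 * (E + δ)) + p n * (4 / ε * Real.log C))
        + p n * d)) := by
        rw [← ENNReal.ofReal_pow (Real.exp_pos _).le, ← ENNReal.ofReal_mul (Real.exp_pos _).le,
          ← ENNReal.ofReal_mul (Real.exp_pos _).le, ← Real.exp_nat_mul, ← Real.exp_add,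
          ← Real.exp_add]
        congr 2
        ring
    _ ≤ _ := ENNReal.ofReal_le_ofReal (Real.exp_le_exp.2 h3)

/-- Borel–Cantelli in the direction that needs no independence, so only the law of each `Λ n`
enters. -/
lemma ae_eventually_le_weight {Ω : Type*} [MeasurableSpace Ω] {P : Measure Ω}
    {β : ℝ} {γ : ℕ} {p : ℕ → ℕ} {wn : ℕ → S → ℝ} (hwn : ∀ n, Continuous (wn n))
    {Λ : (n : ℕ) → Ω → Fin (p n) → S}
    (hΛ : ∀ n, 1 ≤ n → HasLaw (Λ n) (ensembleLaw β γ n (wn n) (p n)) P) {s : ℕ → ℝ}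
    (h : ∀ᶠ n : ℕ in atTop, ensembleLaw β γ n (wn n) (p n)
      {x | weight β γ n (wn n) x < s n} ≤ ENNReal.ofReal (Real.exp (-n))) :
    ∀ᵐ ω ∂P, ∀ᶠ n in atTop, s n ≤ weight β γ n (wn n) (Λ n ω) := by
  obtain ⟨N, hN⟩ := eventually_atTop.1 (h.and (eventually_ge_atTop 1))
  have hsum : ∑' k, P {ω | weight β γ (k + N) (wn (k + N)) (Λ (k + N) ω) < s (k + N)} ≠ ∞ := by
    have h1 : ∀ k : ℕ, P {ω | weight β γ (k + N) (wn (k + N)) (Λ (k + N) ω) < s (k + N)}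
        ≤ ENNReal.ofReal (Real.exp (-k)) := by
      intro k
      obtain ⟨h2, h3⟩ := hN (k + N) (Nat.le_add_left _ _)
      rw [(hΛ (k + N) h3).measure_eq (p := fun x => weight β γ (k + N) (wn (k + N)) x < s (k + N))
        (measurableSet_lt (measurable_weight β γ _ (hwn _)) measurable_const)]
      refine h2.trans (ENNReal.ofReal_le_ofReal (Real.exp_le_exp.2 ?_))
      push_cast
      linarith [(Nat.cast_nonneg N : (0 : ℝ) ≤ N)]
    refine ne_top_of_le_ne_top ?_ (ENNReal.tsum_le_tsum h1)
    exact Real.summable_exp_neg_nat.tsum_ofReal_ne_top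
  filter_upwards [ae_eventually_notMem hsum] with ω hω
  obtain ⟨k, hk⟩ := eventually_atTop.1 hω
  filter_upwards [eventually_ge_atTop (k + N)] with n hn
  have := hk (n - N) (by omega)
  rw [show n - N + N = n by omega] at this
  exact not_lt.1 this

/-! ### Truncated logarithms and the discrete energy -/

/-- The function `-log s`, truncated at the level `M`. -/
noncomputable def truncLog (M s : ℝ) : ℝ := -Real.log (max (Real.exp (-M)) s)

lemma max_exp_pos (M s : ℝ) : 0 < max (Real.exp (-M)) s := lt_max_of_lt_left (Real.exp_pos _)

lemma continuous_truncLog (M : ℝ) : Continuous (truncLog M) :=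
  (Continuous.log (by fun_prop) fun s => (max_exp_pos M s).ne').neg

lemma truncLog_nonneg {M s : ℝ} (hM : 0 ≤ M) (hs : s ≤ 1) : 0 ≤ truncLog M s :=
  neg_log_nonneg (max_exp_pos M s).le (max_le (Real.exp_le_one_iff.2 (neg_nonpos.2 hM)) hs)

lemma truncLog_le (M s : ℝ) : truncLog M s ≤ M := by
  unfold truncLog
  have := Real.log_le_log (Real.exp_pos (-M)) (le_max_left (Real.exp (-M)) s)
  rw [Real.log_exp] at this
  linarith

lemma truncLog_le_neg_log {M s : ℝ} (hs : 0 < s) : truncLog M s ≤ -Real.log s :=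
  neg_le_neg (Real.log_le_log hs (le_max_right _ _))

lemma truncLog_zero (M : ℝ) : truncLog M 0 = M := by
  unfold truncLog
  rw [max_eq_left (Real.exp_pos _).le, Real.log_exp, neg_neg]

lemma truncLog_eq {M s : ℝ} (hs : 0 < s) (hM : -Real.log s ≤ M) : truncLog M s = -Real.log s := by
  unfold truncLog
  rw [max_eq_right]
  rw [← Real.le_log_iff_exp_le hs]
  linarith

/-- A one-sided estimate with an additive error `ζ` uniform in `s`: below `exp (-M)` the truncation
ignores `s`, and above it `ζ = exp (-M) * (exp η - 1)` changes the argument by a factor at most `exp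
η`. It matches the one-sided bound `ScaledWeights.le_add`. -/
lemma truncLog_sub_le {M η : ℝ} (hη : 0 < η) :
    ∃ ζ > 0, ∀ s t : ℝ, 0 < t → t ≤ s + ζ → truncLog M s - η ≤ -Real.log t := by
  refine ⟨Real.exp (-M) * (Real.exp η - 1),
    mul_pos (Real.exp_pos _) (sub_pos.2 (Real.one_lt_exp_iff.2 hη)), fun s t ht hts => ?_⟩
  have hη1 : 0 < Real.exp η - 1 := sub_pos.2 (Real.one_lt_exp_iff.2 hη)
  have h1 : t ≤ max (Real.exp (-M)) s * Real.exp η := by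
    have h2 := le_max_left (Real.exp (-M)) s
    have h3 := le_max_right (Real.exp (-M)) s
    have h4 := mul_le_mul_of_nonneg_right h2 hη1.le
    linarith
  have h5 := Real.log_le_log ht h1
  rw [Real.log_mul (max_exp_pos M s).ne' (Real.exp_pos _).ne', Real.log_exp] at h5
  unfold truncLog
  linarith

lemma empiricalMeasure_coe {m : ℕ} (hm : m ≠ 0) (x : Fin m → S) :
    (empiricalMeasure x : Measure S) = (m : ℝ≥0∞)⁻¹ • ∑ j, Measure.dirac (x j) := by
  unfold empiricalMeasure
  rw [FiniteMeasure.toMeasure_smul, FiniteMeasure.toMeasure_sum, ENNReal.smul_def,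
    ENNReal.coe_inv (by exact_mod_cast hm)]
  rfl

lemma exists_probabilityMeasure_empirical {m : ℕ} (hm : m ≠ 0) (x : Fin m → S) :
    ∃ L : ProbabilityMeasure S, L.toFiniteMeasure = empiricalMeasure x := by
  have : IsProbabilityMeasure (empiricalMeasure x : Measure S) := by
    refine ⟨?_⟩
    rw [empiricalMeasure_coe hm]
    simp only [Measure.smul_apply, Measure.finsetSum_apply, measure_univ, Finset.sum_const,
      Finset.card_univ, Fintype.card_fin, nsmul_eq_mul, mul_one, smul_eq_mul]
    exact ENNReal.inv_mul_cancel (by exact_mod_cast hm) (ENNReal.natCast_ne_top m)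
  exact ⟨⟨empiricalMeasure x, this⟩, rfl⟩

lemma integral_empirical {m : ℕ} (hm : m ≠ 0) {x : Fin m → S} {L : ProbabilityMeasure S}
    (hL : L.toFiniteMeasure = empiricalMeasure x) (f : S → ℝ) :
    ∫ y, f y ∂(L : Measure S) = (m : ℝ)⁻¹ * ∑ j, f (x j) := by
  have h : (L : Measure S) = (m : ℝ≥0∞)⁻¹ • ∑ j, Measure.dirac (x j) := by
    rw [← empiricalMeasure_coe hm, ← hL]
    rfl
  rw [h, integral_smul_measure, integral_finsetSum_measure fun j _ => integrable_dirac (by simp)]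
  simp

lemma integral_prod_empirical {m : ℕ} (hm : m ≠ 0) {x : Fin m → S} {L : ProbabilityMeasure S}
    (hL : L.toFiniteMeasure = empiricalMeasure x) {f : S × S → ℝ}
    (hf : Integrable f ((L : Measure S).prod (L : Measure S))) :
    ∫ z, f z ∂((L : Measure S).prod (L : Measure S))
      = (m : ℝ)⁻¹ * ((m : ℝ)⁻¹ * ∑ i, ∑ j, f (x i, x j)) := by
  rw [integral_prod _ hf, integral_empirical hm hL]
  simp_rw [integral_empirical hm hL, ← Finset.mul_sum]

/-- A lower bound for the weight gives an upper bound for the truncated discrete energy. -/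
lemma discrete_energy_le {β : ℝ} (hβ : 0 < β) {γ n : ℕ} (hn : n ≠ 0) {v : S → ℝ}
    (hv : ∀ x, 0 ≤ v x) {a C : ℝ} (hC : 0 < C) {m : ℕ} {x : Fin m → S}
    {M η : ℝ} {q : S → ℝ}
    (hclose : ∀ y, 0 < v y → truncLog M (q y) - η ≤ -Real.log (scaled a C v y))
    (hG : 0 ≤ n * a - β * γ * (m - 1)) {b : ℝ} (hb : Real.exp (-b) ≤ weight β γ n v x) :
    β / 2 * (∑ i, ∑ j, truncLog M (normDist γ (x i) (x j)) - m * M)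
      + n * (∑ j, truncLog M (q (x j)) - m * η)
      + (n * a - β * γ * (m - 1)) * ∑ j, truncLog M (Real.exp (-growth (x j)))
      ≤ b + n * m * Real.log C := by
  have h0 : 0 < weight β γ n v x := (Real.exp_pos _).trans_le hb
  have hpos := pos_of_weight_pos hn hv h0
  have hne := ne_of_weight_pos hβ h0
  have h1 := neg_log_weight_eq (β := β) (n := n) (a := a) hC hne hpos
  have h2 : -b ≤ Real.log (weight β γ n v x) := (Real.le_log_iff_exp_le h0).2 hb
  have h3 : ∑ i, ∑ j ∈ Finset.Ioi i, truncLog M (normDist γ (x i) (x j))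
      ≤ ∑ i, ∑ j ∈ Finset.Ioi i, -Real.log (normDist γ (x i) (x j)) :=
    Finset.sum_le_sum fun i _ => Finset.sum_le_sum fun j hj =>
      truncLog_le_neg_log (normDist_pos (hne i j (Finset.mem_Ioi.1 hj).ne))
  have h4 := sum_sum_eq_diag_add_two_mul (fun i j => truncLog M (normDist γ (x i) (x j)))
    (fun i j => by rw [normDist_comm])
  -- The truncation makes the diagonal finite, at a total cost of `m * M`, negligible at scale `n ^
  -- 2`.
  have h5 : ∑ i, truncLog M (normDist γ (x i) (x i)) ≤ m * M := by
    calc _ ≤ ∑ _i : Fin m, M := Finset.sum_le_sum fun i _ => truncLog_le _ _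
      _ = _ := by simp
  have h6 : ∑ j, truncLog M (q (x j)) - m * η ≤ ∑ j, -Real.log (scaled a C v (x j)) := by
    calc _ = ∑ j, (truncLog M (q (x j)) - η) := by simp [Finset.sum_sub_distrib]
      _ ≤ _ := Finset.sum_le_sum fun j _ => hclose _ (hpos j)
  have h7 : ∑ j, truncLog M (Real.exp (-growth (x j))) ≤ ∑ j, growth (x j) :=
    Finset.sum_le_sum fun j _ => by
      have := truncLog_le_neg_log (M := M) (Real.exp_pos (-growth (x j)))
      rwa [Real.log_exp, neg_neg] at this
  have h8 := mul_le_mul_of_nonneg_left h7 hG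
  have h9 := mul_le_mul_of_nonneg_left h6 (Nat.cast_nonneg (α := ℝ) n)
  have h10 : β / 2 * (∑ i, ∑ j, truncLog M (normDist γ (x i) (x j)) - m * M)
      ≤ β * ∑ i, ∑ j ∈ Finset.Ioi i, -Real.log (normDist γ (x i) (x j)) := by
    calc _ ≤ β / 2 * (2 * ∑ i, ∑ j ∈ Finset.Ioi i, truncLog M (normDist γ (x i) (x j))) := by
          gcongr; linarith
      _ = β * ∑ i, ∑ j ∈ Finset.Ioi i, truncLog M (normDist γ (x i) (x j)) := by ring
      _ ≤ _ := by gcongr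
  linarith

/-! ### Compactness and lower semicontinuity of the energy -/

/-- The probability measures with a bounded mean of the growth function form a relatively compact
set. -/
lemma isCompact_closure_growth (hS : IsClosed S) (B : ℝ≥0) :
    IsCompact (closure {μ : ProbabilityMeasure S |
      ∫⁻ x, ENNReal.ofReal (growth x) ∂(μ : Measure S) ≤ B}) := by
  refine isCompact_closure_of_isTightMeasureSet ?_
  rw [isTightMeasureSet_iff_exists_isCompact_measure_compl_le]
  intro e he
  -- Tightness by Markov's inequality: outside `[-exp R, exp R]` the growth function is at least
  -- `R`.
  obtain ⟨R, hR0, hR⟩ : ∃ R : ℝ, 0 < R ∧ (B : ℝ≥0∞) / ENNReal.ofReal R ≤ e := by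
    have h : Tendsto (fun R : ℝ => (B : ℝ≥0∞) / ENNReal.ofReal R) atTop (𝓝 ((B : ℝ≥0∞) / ⊤)) :=
      ENNReal.Tendsto.const_div ENNReal.tendsto_ofReal_atTop (Or.inr ENNReal.coe_ne_top)
    rw [ENNReal.div_top] at h
    obtain ⟨R, h1, h2⟩ := ((h.eventually (gt_mem_nhds he)).and (eventually_gt_atTop 0)).exists
    exact ⟨R, h2, h1.le⟩
  refine ⟨Subtype.val ⁻¹' Set.Icc (-Real.exp R) (Real.exp R),
    hS.isClosedEmbedding_subtypeVal.isCompact_preimage isCompact_Icc, ?_⟩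
  rintro _ ⟨μ, hμ, rfl⟩
  have hsub : (Subtype.val ⁻¹' Set.Icc (-Real.exp R) (Real.exp R) : Set S)ᶜ
      ⊆ {x | ENNReal.ofReal R ≤ ENNReal.ofReal (growth x)} := by
    intro x hx
    refine ENNReal.ofReal_le_ofReal ?_
    rw [Set.mem_compl_iff, Set.mem_preimage, Set.mem_Icc, ← abs_le, not_le] at hx
    unfold growth
    rw [Real.le_log_iff_exp_le (one_add_abs_pos x)]
    linarith
  calc (μ : Measure S) _ ≤ (μ : Measure S) {x | ENNReal.ofReal R ≤ ENNReal.ofReal (growth x)} :=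
        measure_mono hsub
    _ ≤ (∫⁻ x, ENNReal.ofReal (growth x) ∂(μ : Measure S)) / ENNReal.ofReal R :=
        meas_ge_le_lintegral_div continuous_growth.measurable.ennreal_ofReal.aemeasurable
          (ENNReal.ofReal_pos.2 hR0).ne' ENNReal.ofReal_ne_top
    _ ≤ (B : ℝ≥0∞) / ENNReal.ofReal R := by gcongr; exact hμ
    _ ≤ e := hR

lemma tendsto_integral_of_bounded {X ι : Type*} [TopologicalSpace X] [MeasurableSpace X]
    [OpensMeasurableSpace X] {F : Filter ι} {L : ι → ProbabilityMeasure X}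
    {ν : ProbabilityMeasure X} (h : Tendsto L F (𝓝 ν)) {f : X → ℝ} (hf : Continuous f) {b : ℝ}
    (hb : ∀ x, |f x| ≤ b) :
    Tendsto (fun n => ∫ x, f x ∂(L n : Measure X)) F (𝓝 (∫ x, f x ∂(ν : Measure X))) :=
  ProbabilityMeasure.tendsto_iff_forall_integral_tendsto.1 h
    (BoundedContinuousFunction.ofNormedAddCommGroup f hf b hb)

/-- The truncated kernel. -/
noncomputable def truncExcess (β κ : ℝ) (γ : ℕ) (ε C : ℝ) (w : S → ℝ) (M : ℝ) (z : S × S) : ℝ :=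
  β / 2 * κ ^ 2 * truncLog M (normDist γ z.1 z.2)
    + κ / 2 * (truncLog M (scaled (γ * κ * β + ε) C w z.1)
      + truncLog M (scaled (γ * κ * β + ε) C w z.2))
    + κ * ε / 2 * (truncLog M (Real.exp (-growth z.1)) + truncLog M (Real.exp (-growth z.2)))

lemma exp_neg_growth_le_one (x : S) : Real.exp (-growth x) ≤ 1 :=
  Real.exp_le_one_iff.2 (neg_nonpos.2 (growth_nonneg x))

lemma tendsto_truncExcess {β κ : ℝ} (hβ : 0 < β) (hκ : 0 < κ) {γ : ℕ} {ε C : ℝ}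
    (hε : 0 < ε) (hC : 0 < C) {w : S → ℝ} (hw : ∀ x, 0 ≤ w x)
    (hq : ∀ x, scaled (γ * κ * β + ε) C w x ≤ 1) (z : S × S) :
    Tendsto (fun k : ℕ => ENNReal.ofReal (truncExcess β κ γ ε C w k z)) atTop
      (𝓝 (excess β κ γ ε C w z)) := by
  have n1 : ∀ k : ℕ, 0 ≤ truncLog k (normDist γ z.1 z.2) := fun k =>
    truncLog_nonneg k.cast_nonneg (normDist_le_one _ _ _)
  have n2 : ∀ (k : ℕ) (x : S), 0 ≤ truncLog k (scaled (γ * κ * β + ε) C w x) := fun k x =>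
    truncLog_nonneg k.cast_nonneg (hq x)
  have n3 : ∀ (k : ℕ) (x : S), 0 ≤ truncLog k (Real.exp (-growth x)) := fun k x =>
    truncLog_nonneg k.cast_nonneg (exp_neg_growth_le_one x)
  have hb : 0 < β / 2 * κ ^ 2 := by positivity
  have hk : 0 < κ / 2 := by positivity
  have hke : 0 < κ * ε / 2 := by positivity
  unfold excess
  split_ifs with h
  -- On the singular set one truncated logarithm equals its level `k` and the other terms are
  -- nonnegative, so the sum tends to infinity.
  · have hlow : ∃ c > 0, ∀ k : ℕ, c * k ≤ truncExcess β κ γ ε C w k z := by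
      rcases h with h | h | h
      · refine ⟨_, hb, fun k => ?_⟩
        have : truncLog k (normDist γ z.1 z.2) = k := by
          unfold normDist
          rw [h, sub_self, abs_zero, zero_div, truncLog_zero]
        unfold truncExcess
        rw [this]
        have := mul_nonneg hk.le (add_nonneg (n2 k z.1) (n2 k z.2))
        have := mul_nonneg hke.le (add_nonneg (n3 k z.1) (n3 k z.2))
        linarith
      · refine ⟨_, hk, fun k => ?_⟩
        have : truncLog k (scaled (γ * κ * β + ε) C w z.1) = k := by
          unfold scaled
          rw [h, zero_mul, zero_div, truncLog_zero]
        unfold truncExcess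
        rw [this]
        have := mul_nonneg hb.le (n1 k)
        have := mul_nonneg hk.le (n2 k z.2)
        have := mul_nonneg hke.le (add_nonneg (n3 k z.1) (n3 k z.2))
        linarith
      · refine ⟨_, hk, fun k => ?_⟩
        have : truncLog k (scaled (γ * κ * β + ε) C w z.2) = k := by
          unfold scaled
          rw [h, zero_mul, zero_div, truncLog_zero]
        unfold truncExcess
        rw [this]
        have := mul_nonneg hb.le (n1 k)
        have := mul_nonneg hk.le (n2 k z.1)
        have := mul_nonneg hke.le (add_nonneg (n3 k z.1) (n3 k z.2))
        linarith
    obtain ⟨c, hc, hlow⟩ := hlow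
    exact ENNReal.tendsto_ofReal_atTop.comp (tendsto_atTop_mono hlow
      (tendsto_natCast_atTop_atTop.const_mul_atTop hc))
  · push Not at h
    obtain ⟨h1, h2, h3⟩ := h
    have hp1 := scaled_pos (a := γ * κ * β + ε) hC ((hw _).lt_of_ne' h2)
    have hp2 := scaled_pos (a := γ * κ * β + ε) hC ((hw _).lt_of_ne' h3)
    have hlarge : ∀ b : ℝ, ∀ᶠ k : ℕ in atTop, b ≤ k := fun b =>
      tendsto_natCast_atTop_atTop.eventually_ge_atTop b
    refine tendsto_const_nhds.congr' ?_
    filter_upwards [hlarge (-Real.log (normDist γ z.1 z.2)),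
      hlarge (-Real.log (scaled (γ * κ * β + ε) C w z.1)),
      hlarge (-Real.log (scaled (γ * κ * β + ε) C w z.2)), hlarge (growth z.1),
      hlarge (growth z.2)] with k k1 k2 k3 k4 k5
    unfold truncExcess excessReal
    rw [truncLog_eq (normDist_pos h1) k1, truncLog_eq hp1 k2, truncLog_eq hp2 k3,
      truncLog_eq (Real.exp_pos _) (by rwa [Real.log_exp, neg_neg]),
      truncLog_eq (Real.exp_pos _) (by rwa [Real.log_exp, neg_neg]),
      Real.log_exp, Real.log_exp, neg_neg, neg_neg]

/-- The truncated kernels are nonnegative and converge pointwise to the excess, so Fatou's lemma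
carries a bound uniform in the level over to the full energy. -/
lemma lintegral_excess_le {β κ : ℝ} (hβ : 0 < β) (hκ : 0 < κ) {γ : ℕ} {ε C : ℝ}
    (hε : 0 < ε) (hC : 0 < C) {w : S → ℝ} (hwc : Continuous w) (hw : ∀ x, 0 ≤ w x)
    (hq : ∀ x, scaled (γ * κ * β + ε) C w x ≤ 1) {ν : Measure S} [IsProbabilityMeasure ν] {b : ℝ}
    (h : ∀ k : ℕ, β / 2 * κ ^ 2 * ∫ z : S × S, truncLog k (normDist γ z.1 z.2) ∂(ν.prod ν)
      + κ * ∫ x, truncLog k (scaled (γ * κ * β + ε) C w x) ∂ν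
      + κ * ε * ∫ x, truncLog k (Real.exp (-growth x)) ∂ν ≤ b) :
    ∫⁻ z, excess β κ γ ε C w z ∂(ν.prod ν) ≤ ENNReal.ofReal b := by
  have c1 : ∀ k : ℕ, Continuous fun z : S × S => truncLog k (normDist γ z.1 z.2) := fun k =>
    (continuous_truncLog k).comp (continuous_normDist γ)
  have c2 : ∀ k : ℕ, Continuous fun x : S => truncLog k (scaled (γ * κ * β + ε) C w x) := fun k =>
    (continuous_truncLog k).comp (continuous_scaled hwc)
  have c3 : ∀ k : ℕ, Continuous fun x : S => truncLog k (Real.exp (-growth x)) := fun k =>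
    (continuous_truncLog k).comp (Real.continuous_exp.comp continuous_growth.neg)
  have n1 : ∀ (k : ℕ) (z : S × S), 0 ≤ truncLog k (normDist γ z.1 z.2) := fun k z =>
    truncLog_nonneg k.cast_nonneg (normDist_le_one _ _ _)
  have n2 : ∀ (k : ℕ) (x : S), 0 ≤ truncLog k (scaled (γ * κ * β + ε) C w x) := fun k x =>
    truncLog_nonneg k.cast_nonneg (hq x)
  have n3 : ∀ (k : ℕ) (x : S), 0 ≤ truncLog k (Real.exp (-growth x)) := fun k x =>
    truncLog_nonneg k.cast_nonneg (exp_neg_growth_le_one x)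
  have i1 : ∀ k : ℕ, Integrable (fun z : S × S => truncLog k (normDist γ z.1 z.2)) (ν.prod ν) :=
    fun k => Integrable.of_bound (c1 k).measurable.aestronglyMeasurable (k : ℝ)
      (Eventually.of_forall fun z => by
        rw [Real.norm_eq_abs, abs_of_nonneg (n1 k z)]; exact truncLog_le _ _)
  have i2 : ∀ k : ℕ, Integrable (fun x : S => truncLog k (scaled (γ * κ * β + ε) C w x)) ν :=
    fun k => Integrable.of_bound (c2 k).measurable.aestronglyMeasurable (k : ℝ)
      (Eventually.of_forall fun z => by
        rw [Real.norm_eq_abs, abs_of_nonneg (n2 k z)]; exact truncLog_le _ _)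
  have i3 : ∀ k : ℕ, Integrable (fun x : S => truncLog k (Real.exp (-growth x))) ν :=
    fun k => Integrable.of_bound (c3 k).measurable.aestronglyMeasurable (k : ℝ)
      (Eventually.of_forall fun z => by
        rw [Real.norm_eq_abs, abs_of_nonneg (n3 k z)]; exact truncLog_le _ _)
  have hmeas : ∀ k : ℕ, Measurable fun z => ENNReal.ofReal (truncExcess β κ γ ε C w k z) := by
    intro k
    refine Measurable.ennreal_ofReal ?_
    unfold truncExcess
    exact (((c1 k).measurable.const_mul _).add
      ((((c2 k).measurable.comp measurable_fst).add
        ((c2 k).measurable.comp measurable_snd)).const_mul _)).add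
      ((((c3 k).measurable.comp measurable_fst).add
        ((c3 k).measurable.comp measurable_snd)).const_mul _)
  have hk : ∀ k : ℕ, ∫⁻ z, ENNReal.ofReal (truncExcess β κ γ ε C w k z) ∂(ν.prod ν)
      ≤ ENNReal.ofReal b := by
    intro k
    have j1 : Integrable (fun z : S × S => β / 2 * κ ^ 2 * truncLog k (normDist γ z.1 z.2))
      (ν.prod ν) := (i1 k).const_mul _
    have j2 : Integrable (fun z : S × S => κ / 2 * (truncLog k (scaled (γ * κ * β + ε) C w z.1)
      + truncLog k (scaled (γ * κ * β + ε) C w z.2))) (ν.prod ν) :=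
      (((i2 k).comp_fst ν).add ((i2 k).comp_snd ν)).const_mul _
    have j3 : Integrable (fun z : S × S => κ * ε / 2 * (truncLog k (Real.exp (-growth z.1))
      + truncLog k (Real.exp (-growth z.2)))) (ν.prod ν) :=
      (((i3 k).comp_fst ν).add ((i3 k).comp_snd ν)).const_mul _
    have j12 : Integrable (fun z : S × S => β / 2 * κ ^ 2 * truncLog k (normDist γ z.1 z.2)
      + κ / 2 * (truncLog k (scaled (γ * κ * β + ε) C w z.1)
      + truncLog k (scaled (γ * κ * β + ε) C w z.2))) (ν.prod ν) := j1.add j2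
    have hint : Integrable (truncExcess β κ γ ε C w k) (ν.prod ν) := j12.add j3
    have hval : ∫ z, truncExcess β κ γ ε C w k z ∂(ν.prod ν)
        = β / 2 * κ ^ 2 * ∫ z : S × S, truncLog k (normDist γ z.1 z.2) ∂(ν.prod ν)
          + κ * ∫ x, truncLog k (scaled (γ * κ * β + ε) C w x) ∂ν
          + κ * ε * ∫ x, truncLog k (Real.exp (-growth x)) ∂ν := by
      unfold truncExcess
      rw [integral_add j12 j3, integral_add j1 j2, integral_const_mul, integral_const_mul,
        integral_const_mul, integral_add ((i2 k).comp_fst ν) ((i2 k).comp_snd ν),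
        integral_add ((i3 k).comp_fst ν) ((i3 k).comp_snd ν),
        integral_fun_fst fun x => truncLog k (scaled (γ * κ * β + ε) C w x),
        integral_fun_snd fun x => truncLog k (scaled (γ * κ * β + ε) C w x),
        integral_fun_fst fun x => truncLog k (Real.exp (-growth x)),
        integral_fun_snd fun x => truncLog k (Real.exp (-growth x))]
      simp only [probReal_univ, one_smul]
      ring
    rw [← ofReal_integral_eq_lintegral_ofReal hint (Eventually.of_forall fun z => ?_), hval]
    · exact ENNReal.ofReal_le_ofReal (h k)
    · have a1 := n1 k z
      have a2 := add_nonneg (n2 k z.1) (n2 k z.2)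
      have a3 := add_nonneg (n3 k z.1) (n3 k z.2)
      simp only [Pi.zero_apply, truncExcess]
      positivity
  calc ∫⁻ z, excess β κ γ ε C w z ∂(ν.prod ν)
      = ∫⁻ z, liminf (fun k : ℕ => ENNReal.ofReal (truncExcess β κ γ ε C w k z)) atTop
          ∂(ν.prod ν) :=
        lintegral_congr fun z => (tendsto_truncExcess hβ hκ hε hC hw hq z).liminf_eq.symm
    _ ≤ liminf (fun k : ℕ => ∫⁻ z, ENNReal.ofReal (truncExcess β κ γ ε C w k z) ∂(ν.prod ν))
          atTop := lintegral_liminf_le hmeas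
    _ ≤ liminf (fun _ : ℕ => ENNReal.ofReal b) atTop :=
        liminf_le_liminf (Eventually.of_forall hk)
    _ = _ := liminf_const _

lemma lintegral_growth_empirical {m : ℕ} (hm : m ≠ 0) {x : Fin m → S} {L : ProbabilityMeasure S}
    (hL : L.toFiniteMeasure = empiricalMeasure x) :
    ∫⁻ y, ENNReal.ofReal (growth y) ∂(L : Measure S)
      = ENNReal.ofReal ((m : ℝ)⁻¹ * ∑ j, growth (x j)) := by
  have h : (L : Measure S) = (m : ℝ≥0∞)⁻¹ • ∑ j, Measure.dirac (x j) := by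
    rw [← empiricalMeasure_coe hm, ← hL]
    rfl
  have hm0 : (0 : ℝ) < m := by exact_mod_cast Nat.pos_of_ne_zero hm
  rw [h, lintegral_smul_measure, lintegral_finsetSum_measure,
    ENNReal.ofReal_mul (inv_nonneg.2 hm0.le), ENNReal.ofReal_inv_of_pos hm0, ENNReal.ofReal_natCast,
    ENNReal.ofReal_sum_of_nonneg fun j _ => growth_nonneg _, smul_eq_mul]
  simp_rw [lintegral_dirac]

/-! ### Convergence along configurations of nearly maximal weight -/

section

variable {β κ ε C E : ℝ} {γ : ℕ} {p : ℕ → ℕ} {wn : ℕ → S → ℝ} {w : S → ℝ}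
  {x : (n : ℕ) → Fin (p n) → S} {L : ℕ → ProbabilityMeasure S}

lemma tendsto_growth_coeff (hp : Tendsto (fun n : ℕ => (p n : ℝ) / n) atTop (𝓝 κ)) :
    Tendsto (fun n : ℕ => ((n : ℝ) * (γ * κ * β + ε) - β * γ * ((p n : ℝ) - 1)) / n) atTop
      (𝓝 ε) := by
  have hinv : Tendsto (fun n : ℕ => (1 : ℝ) / n) atTop (𝓝 0) := tendsto_one_div_atTop_nhds_zero_nat
  have h1 : Tendsto (fun n : ℕ => (γ * κ * β + ε) - β * γ * ((p n : ℝ) / n - 1 / n)) atTop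
      (𝓝 ((γ * κ * β + ε) - β * γ * (κ - 0))) := ((hp.sub hinv).const_mul _).const_sub _
  have h2 : (γ * κ * β + ε) - β * γ * (κ - 0) = ε := by ring
  rw [h2] at h1
  refine h1.congr' ?_
  filter_upwards [eventually_ge_atTop 1] with n hn
  have hn0 : (0 : ℝ) < n := by exact_mod_cast hn
  field_simp

/-- Configurations of large weight have empirical measures in a relatively compact set. -/
lemma exists_eventually_growth_le (hβ : 0 < β) (hκ : 0 < κ) (hε : 0 < ε)
    (hp : Tendsto (fun n : ℕ => (p n : ℝ) / n) atTop (𝓝 κ)) (hnn : ∀ n x, 0 ≤ wn n x)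
    (hsc : ScaledWeights wn w (γ * κ * β + ε) C)
    (hx : ∀ δ > 0, ∀ᶠ n : ℕ in atTop,
      Real.exp (-((n : ℝ) ^ 2 * (E + δ))) ≤ weight β γ n (wn n) (x n))
    (hL : ∀ n, p n ≠ 0 → (L n).toFiniteMeasure = empiricalMeasure (x n)) :
    ∃ B : ℝ≥0, ∀ᶠ n in atTop, ∫⁻ y, ENNReal.ofReal (growth y) ∂(L n : Measure S) ≤ B := by
  set G : ℕ → ℝ := fun n => (n : ℝ) * (γ * κ * β + ε) - β * γ * ((p n : ℝ) - 1) with hG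
  have hGlim : Tendsto (fun n : ℕ => G n / n) atTop (𝓝 ε) := tendsto_growth_coeff hp
  have hlim : Tendsto (fun n : ℕ => ((p n : ℝ) / n * Real.log C + (E + 1))
      / (G n / n * ((p n : ℝ) / n))) atTop (𝓝 ((κ * Real.log C + (E + 1)) / (ε * κ))) :=
    ((hp.mul_const _).add_const _).div (hGlim.mul hp) (mul_pos hε hκ).ne'
  set B := (κ * Real.log C + (E + 1)) / (ε * κ) + 1 with hB
  refine ⟨B.toNNReal, ?_⟩
  filter_upwards [hx 1 one_pos, hlim.eventually (gt_mem_nhds (show _ < B by linarith)),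
    hGlim.eventually (lt_mem_nhds hε), hp.eventually (lt_mem_nhds hκ), hsc.le_one,
    eventually_ge_atTop 1] with n h1 h2 h3 h4 h5 h6
  have hn0 : (0 : ℝ) < n := by exact_mod_cast h6
  have hp0 : p n ≠ 0 := by
    rintro h
    rw [h] at h4
    simp at h4
  rw [lintegral_growth_empirical hp0 (hL n hp0)]
  refine ENNReal.ofReal_le_ofReal (le_trans ?_ h2.le)
  have hw0 := (Real.exp_pos _).trans_le h1
  have h7 := log_weight_le hβ (by omega) (hnn n) (zero_lt_one.trans_le hsc.one_le) h5 hw0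
  have h8 := (Real.le_log_iff_exp_le hw0).2 h1
  -- Discarding the nonnegative interaction and weight terms leaves only the growth term, whose
  -- coefficient `G n` is positive of order `n`.
  have h9 : G n * ∑ j, growth (x n j) ≤ n * p n * Real.log C + (n : ℝ) ^ 2 * (E + 1) := by
    linarith
  rw [le_div_iff₀ (mul_pos h3 h4)]
  have hp1 : (0 : ℝ) < p n := by exact_mod_cast Nat.pos_of_ne_zero hp0
  calc (p n : ℝ)⁻¹ * (∑ j, growth (x n j)) * (G n / n * (p n / n))
      = (G n * ∑ j, growth (x n j)) / (n : ℝ) ^ 2 := by field_simp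
    _ ≤ (n * p n * Real.log C + (n : ℝ) ^ 2 * (E + 1)) / (n : ℝ) ^ 2 := by gcongr
    _ = (p n : ℝ) / n * Real.log C + (E + 1) := by field_simp

/-- The energy of the empirical measures is lower semicontinuous along a convergent filter. -/
lemma truncated_energy_le (hβ : 0 < β) (hκ : 0 < κ) (hε : 0 < ε)
    (hp : Tendsto (fun n : ℕ => (p n : ℝ) / n) atTop (𝓝 κ)) (hnn : ∀ n x, 0 ≤ wn n x)
    (hwc : Continuous w)
    (hsc : ScaledWeights wn w (γ * κ * β + ε) C)
    (hx : ∀ δ > 0, ∀ᶠ n : ℕ in atTop,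
      Real.exp (-((n : ℝ) ^ 2 * (E + δ))) ≤ weight β γ n (wn n) (x n))
    (hL : ∀ n, p n ≠ 0 → (L n).toFiniteMeasure = empiricalMeasure (x n))
    {F : Filter ℕ} [F.NeBot] (hF : F ≤ atTop) {ν : ProbabilityMeasure S}
    (hν : Tendsto L F (𝓝 ν)) {M : ℝ} (hM : 0 ≤ M) :
    β / 2 * κ ^ 2 * ∫ z : S × S, truncLog M (normDist γ z.1 z.2) ∂((ν : Measure S).prod ν)
      + κ * ∫ y, truncLog M (scaled (γ * κ * β + ε) C w y) ∂(ν : Measure S)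
      + κ * ε * ∫ y, truncLog M (Real.exp (-growth y)) ∂(ν : Measure S)
      ≤ E + κ * Real.log C := by
  have hC0 : 0 < C := zero_lt_one.trans_le hsc.one_le
  have c1 : Continuous fun z : S × S => truncLog M (normDist γ z.1 z.2) :=
    (continuous_truncLog M).comp (continuous_normDist γ)
  have c2 : Continuous fun y : S => truncLog M (scaled (γ * κ * β + ε) C w y) :=
    (continuous_truncLog M).comp (continuous_scaled hwc)
  have c3 : Continuous fun y : S => truncLog M (Real.exp (-growth y)) :=
    (continuous_truncLog M).comp (Real.continuous_exp.comp continuous_growth.neg)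
  have b1 : ∀ z : S × S, |truncLog M (normDist γ z.1 z.2)| ≤ M := fun z => by
    rw [abs_of_nonneg (truncLog_nonneg hM (normDist_le_one _ _ _))]
    exact truncLog_le _ _
  have b2 : ∀ y : S, |truncLog M (scaled (γ * κ * β + ε) C w y)| ≤ M := fun y => by
    rw [abs_of_nonneg (truncLog_nonneg hM (hsc.limit_le_one y))]
    exact truncLog_le _ _
  have b3 : ∀ y : S, |truncLog M (Real.exp (-growth y))| ≤ M := fun y => by
    rw [abs_of_nonneg (truncLog_nonneg hM (exp_neg_growth_le_one y))]
    exact truncLog_le _ _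
  have hprod : Tendsto (fun n => (L n).prod (L n)) F (𝓝 (ν.prod ν)) :=
    (ProbabilityMeasure.continuous_prod.tendsto (ν, ν)).comp (hν.prodMk_nhds hν)
  have t1 := tendsto_integral_of_bounded hprod c1 b1
  have t2 := tendsto_integral_of_bounded hν c2 b2
  have t3 := tendsto_integral_of_bounded hν c3 b3
  simp only [ProbabilityMeasure.toMeasure_prod] at t1
  set G : ℕ → ℝ := fun n => (n : ℝ) * (γ * κ * β + ε) - β * γ * ((p n : ℝ) - 1) with hG
  have hGlim : Tendsto (fun n : ℕ => G n / n) atTop (𝓝 ε) := tendsto_growth_coeff hp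
  have hinv : Tendsto (fun n : ℕ => (1 : ℝ) / n) atTop (𝓝 0) := tendsto_one_div_atTop_nhds_zero_nat
  have key : ∀ δ > 0, β / 2 * (κ * κ * ∫ z : S × S, truncLog M (normDist γ z.1 z.2)
          ∂((ν : Measure S).prod ν) - κ * 0 * M)
      + κ * (∫ y, truncLog M (scaled (γ * κ * β + ε) C w y) ∂(ν : Measure S) - δ)
      + ε * κ * ∫ y, truncLog M (Real.exp (-growth y)) ∂(ν : Measure S)
      ≤ E + δ + κ * Real.log C := by
    intro δ hδ
    obtain ⟨ζ, hζ, hclose⟩ := truncLog_sub_le (M := M) hδ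
    have hpF := hp.mono_left hF
    -- The inequality `discrete_energy_le`, divided by `n ^ 2`, passes to the limit term by term;
    -- the diagonal term `p n * M / n ^ 2` vanishes.
    refine le_of_tendsto_of_tendsto
      (((((hpF.mul hpF).mul t1).sub ((hpF.mul (hinv.mono_left hF)).mul_const M)).const_mul
        (β / 2)).add (hpF.mul (t2.sub_const δ)) |>.add (((hGlim.mono_left hF).mul hpF).mul t3))
      ((hpF.mul_const (Real.log C)).const_add (E + δ)) (hF ?_)
    filter_upwards [hx δ hδ, hGlim.eventually (lt_mem_nhds hε), hp.eventually (lt_mem_nhds hκ),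
      hsc.le_add ζ hζ, eventually_ge_atTop 1] with n h1 h3 h4 h5 h6
    have hn0 : (0 : ℝ) < n := by exact_mod_cast h6
    have hp0 : p n ≠ 0 := by
      rintro h
      rw [h] at h4
      simp at h4
    have hp1 : (0 : ℝ) < p n := by exact_mod_cast Nat.pos_of_ne_zero hp0
    have hGn : 0 ≤ G n := by
      have := mul_pos h3 hn0
      rw [div_mul_cancel₀ _ hn0.ne'] at this
      exact this.le
    have h7 := discrete_energy_le hβ (by omega) (hnn n) hC0 (a := γ * κ * β + ε)
      (q := scaled (γ * κ * β + ε) C w) (M := M) (η := δ)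
      (fun y hy => hclose _ _ (scaled_pos hC0 hy) (h5 y)) hGn h1
    rw [integral_prod_empirical hp0 (hL n hp0) (Integrable.of_bound
      c1.measurable.aestronglyMeasurable M (Eventually.of_forall b1)),
      integral_empirical hp0 (hL n hp0), integral_empirical hp0 (hL n hp0)]
    have h8 := div_le_div_of_nonneg_right h7 (sq_nonneg (n : ℝ))
    convert h8 using 1
    · field_simp
      simp only [hG]
      ring
    · field_simp
  have hlim : Tendsto (fun δ : ℝ => E + δ + κ * Real.log C + κ * δ) (𝓝[>] 0)
      (𝓝 (E + κ * Real.log C)) := by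
    have : Continuous fun δ : ℝ => E + δ + κ * Real.log C + κ * δ := by fun_prop
    exact (this.tendsto' 0 _ (by ring)).mono_left nhdsWithin_le_nhds
  refine ge_of_tendsto hlim ?_
  filter_upwards [self_mem_nhdsWithin] with δ hδ
  have := key δ hδ
  linarith

/-- The empirical measures of configurations of nearly maximal weight converge to the minimizer of
the energy. -/
lemma tendsto_empiricalMeasure (hS : IsClosed S) (hβ : 0 < β) (hκ : 0 < κ) (hε : 0 < ε)
    (hp : Tendsto (fun n : ℕ => (p n : ℝ) / n) atTop (𝓝 κ)) (hnn : ∀ n x, 0 ≤ wn n x)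
    (hwc : Continuous w) (hw : ∀ x, 0 ≤ w x)
    (hsc : ScaledWeights wn w (γ * κ * β + ε) C) {μs : ProbabilityMeasure S}
    (hE : energy β κ γ w μs = E) (hu : ∀ μ, energy β κ γ w μ ≤ E → μ = μs)
    (hx : ∀ δ > 0, ∀ᶠ n : ℕ in atTop,
      Real.exp (-((n : ℝ) ^ 2 * (E + δ))) ≤ weight β γ n (wn n) (x n)) :
    Tendsto (fun n => empiricalMeasure (x n)) atTop (𝓝 μs.toFiniteMeasure) := by
  have hC0 : 0 < C := zero_lt_one.trans_le hsc.one_le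
  have hEB := (lintegral_excess_of_energy_eq hβ hκ hε hsc.one_le hwc hw hsc.limit_le_one hE).2
  have : ∀ n, ∃ L : ProbabilityMeasure S,
      p n ≠ 0 → L.toFiniteMeasure = empiricalMeasure (x n) := by
    intro n
    by_cases h : p n = 0
    -- For `p n = 0` the empirical measure is zero rather than a probability measure; the value
    -- chosen here is arbitrary, as `p n > 0` eventually.
    · exact ⟨μs, fun h' => absurd h h'⟩
    · obtain ⟨L, hL⟩ := exists_probabilityMeasure_empirical h (x n)
      exact ⟨L, fun _ => hL⟩
  choose L hL using this
  obtain ⟨B, hB⟩ := exists_eventually_growth_le hβ hκ hε hp hnn hsc hx hL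
  have hlim : Tendsto L atTop (𝓝 μs) := by
    refine (isCompact_closure_growth hS B).tendsto_nhds_of_unique_mapClusterPt
      (hB.mono fun n hn => subset_closure hn) fun ν _ hν => hu ν ?_
    obtain ⟨U, hU, hUν⟩ := mapClusterPt_iff_ultrafilter.1 hν
    refine energy_le_of_lintegral_excess_le hβ hκ hε hsc.one_le hwc hw hsc.limit_le_one hEB ?_
    exact lintegral_excess_le hβ hκ hε hC0 hwc hw hsc.limit_le_one fun k =>
      truncated_energy_le hβ hκ hε hp hnn hwc hsc hx hL hU hUν k.cast_nonneg
  rw [ProbabilityMeasure.tendsto_nhds_iff_toFiniteMeasure_tendsto_nhds] at hlim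
  refine hlim.congr' ?_
  filter_upwards [hp.eventually (lt_mem_nhds hκ)] with n h4
  refine hL n ?_
  rintro h
  rw [h] at h4
  simp at h4

end

/-! ### Nondegeneracy of the interval and the theorem -/

/-- A set with at most one point is Lebesgue null, so for `m ≥ 1` the ensemble law on it would be
zero, which is not the law of a random vector. -/
lemma nontrivial_of_hasLaw {Ω : Type*} [MeasurableSpace Ω] {P : Measure Ω}
    [IsProbabilityMeasure P] {S : Set ℝ} (hS : IsClosed S) {β : ℝ} {γ n : ℕ} {v : S → ℝ} {m : ℕ}
    (hm : m ≠ 0) {X : Ω → Fin m → S} (hX : HasLaw X (ensembleLaw β γ n v m) P) :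
    Nontrivial S := by
  have hσ := sigmaFinite_comap_coe hS.measurableSet
  by_contra h
  rw [not_nontrivial_iff_subsingleton] at h
  have hvol : Measure.comap ((↑) : S → ℝ) volume = 0 := by
    rw [← Measure.measure_univ_eq_zero,
      (MeasurableEmbedding.subtype_coe hS.measurableSet).comap_apply]
    exact ((Set.subsingleton_of_subsingleton (s := Set.univ)).image _).measure_zero _
  have hleb : lebesgue S m = 0 := by
    rw [← Measure.measure_univ_eq_zero, lebesgue, Measure.pi_univ, hvol]
    simp [hm]
  have h1 : ensembleLaw β γ n v m = 0 := by
    rw [ensembleLaw, hleb, withDensity_zero_left]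
  have h2 := Measure.isProbabilityMeasure_map (μ := P) hX.aemeasurable
  rw [hX.map_eq, h1] at h2
  exact h2.ne_zero _ rfl

end LogGas

theorem corollary3p2 {Ω : Type*} [MeasurableSpace Ω] (P : Measure Ω) [IsProbabilityMeasure P]
    (β κ : ℝ) (hβ : 0 < β) (hκ : 0 < κ) (γ : ℕ) (hγ : 1 ≤ γ)
    (S : Set ℝ) (hS_closed : IsClosed S) (hS_interval : S.OrdConnected)
    (hS_nonneg : Even γ → S ⊆ Set.Ici 0)
    (p : ℕ → ℕ) (hp : Tendsto (fun n : ℕ => (p n : ℝ) / n) atTop (𝓝 κ))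
    (wn : ℕ → S → ℝ) (hwn_cont : ∀ n, Continuous (wn n)) (hwn_nonneg : ∀ n x, 0 ≤ wn n x)
    (w : S → ℝ) (ha1 : LogGas.WeightLimit wn w) (ha2 : LogGas.WeightDecay β κ γ wn)
    (Λ : (n : ℕ) → Ω → Fin (p n) → S)
    (hΛ : ∀ n, 1 ≤ n → HasLaw (Λ n) (LogGas.ensembleLaw β γ n (wn n) (p n)) P)
    (μstar : ProbabilityMeasure S)
    (hμstar : LogGas.IsUniqueMinimizer (LogGas.rateFunction β κ γ p wn w) μstar) :
    ∀ᵐ ω ∂P, Tendsto (fun n => LogGas.empiricalMeasure (Λ n ω)) atTop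
      (𝓝 μstar.toFiniteMeasure) := by
  obtain ⟨n, hpn, hn⟩ := ((hp.eventually (lt_mem_nhds hκ)).and (eventually_ge_atTop 1)).exists
  have : Nontrivial S := by
    refine LogGas.nontrivial_of_hasLaw hS_closed ?_ (hΛ n hn)
    rintro h
    rw [h] at hpn
    simp at hpn
  obtain ⟨ε, hε, C, hsc⟩ :=
    LogGas.exists_scaledWeights hS_closed hwn_nonneg ha1 hβ hκ ha2
  obtain ⟨E, hE, huniq⟩ := LogGas.exists_energy_eq_coe (J := LogGas.energy β κ γ w)
    (fun μ => by
      rw [LogGas.energy_eq hβ hκ hε hsc.one_le ha1.continuous ha1.nonneg hsc.limit_le_one]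
      exact LogGas.coe_ennreal_sub_coe_ne_bot _ _) hμstar
  have hZ : ∀ e > E, ∀ᶠ n : ℕ in atTop, ENNReal.ofReal (Real.exp (-((n : ℝ) ^ 2 * e)))
      ≤ LogGas.partitionFunction β γ n (wn n) (p n) := fun e he =>
    LogGas.eventually_exp_le_partitionFunction hS_closed hS_interval hβ hκ hγ hS_nonneg hp
      hwn_cont hwn_nonneg ha1 hε hsc hE he
  -- The sequence `1 / (k + 1)` reduces all `δ > 0` to countably many almost sure events.
  have hae : ∀ᵐ ω ∂P, ∀ k : ℕ, ∀ᶠ n : ℕ in atTop,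
      Real.exp (-((n : ℝ) ^ 2 * (E + 1 / ((k : ℝ) + 1))))
        ≤ LogGas.weight β γ n (wn n) (Λ n ω) := by
    rw [ae_all_iff]
    exact fun k => LogGas.ae_eventually_le_weight hwn_cont hΛ
      (LogGas.eventually_ensembleLaw_le hS_closed hβ hp hwn_cont hwn_nonneg hε hsc hZ
        Nat.one_div_pos_of_nat)
  filter_upwards [hae] with ω hω
  refine LogGas.tendsto_empiricalMeasure hS_closed hβ hκ hε hp hwn_nonneg ha1.continuous
    ha1.nonneg hsc hE huniq fun δ hδ => ?_
  obtain ⟨k, hk⟩ := exists_nat_one_div_lt hδ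
  filter_upwards [hω k] with n h1
  refine (Real.exp_le_exp.2 ?_).trans h1
  gcongr
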